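/- Surreal numbers are pairs $x=\{L_x\mid R_x\}$ of sets of surreal numbers such that no member of $R_x$ is $\le$ any member of $L_x$, where $x\le y$ iff $y$ is $\le$ no member of $L_x$ and no member of $R_y$ is $\le x$; write $x\approx y$ for $x\le y\wedge y\le x$. The operations $-,+,\cdot,{}^{-1}$ are Conway's recursively defined operations on these pairs (with $x^{-1}=-(-x)^{-1}$ for $x<0$), and $a/b=a\cdot b^{-1}$. For a surreal $x$ and sets $A,B$ of surreals let $$S(x,A,B)=\Big\{\tfrac{x+a\cdot b}{a+b}\;\Big|\;a\in A,\ b\in B,\ a+b\not\approx 0\Big\}.$$ Clive Bach's square root is defined recursively by $\sqrt x=\{\bigcup_{n}L_n\mid\bigcup_{n}R_n\}$, where $$L_0=\{\sqrt{x^L}\mid x^L\in L_x,\ 0\le x^L\},\qquad R_0=\{\sqrt{x^R}\mid x^R\in R_x,\ 0\le x^R\},$$ $$L_{n+1}=L_n\cup S(x,L_n,R_n),\qquad R_{n+1}=R_n\cup S(x,L_n,L_n)\cup S(x,R_n,R_n).$$ Then: 1. $\sqrt x$ is a surreal number for every surreal number $x$, in particular for every $x\ge 0$. 2. $\sqrt{x\cdot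 x}\approx x$ for every surreal $x\ge 0$. 3. $(\sqrt x)^{-1}\approx\sqrt{x^{-1}}$ for every surreal $x>0$. 4. On negative numbers $\sqrt{\cdot}$ is not invariant under $\approx$: there are surreals $y\approx z\approx -1$ with $\sqrt y\not\approx\sqrt z$. More precisely, $\sqrt{-1}=-1$ (equality of pairs of sets, where $-1=\{\,\mid 0\}$), while for every surreal $x>0$ the pair $$y=\{\,\mid 0,\ (\sqrt{x\cdot x+1}-x)\cdot(\sqrt{x\cdot x+1}-x)\}$$ is a surreal number with $y\approx -1$ and $\sqrt y<-x$. Consequently, for every surreal $x<0$ there is a surreal $y\approx -1$ with $\sqrt y<x$. -/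

import Mathlib

universe u

noncomputable section

/-- Formal pairs `{L | R}` of small families of previously constructed pairs. A set of pairs is
presented by an indexed family `α → Game`, with `α` a small type; a surreal number will be a
`Game` with the hereditary property `Game.IsSurreal` below. -/
inductive Game : Type (u + 1)
  | mk (α β : Type u) (L : α → Game) (R : β → Game) : Game

namespace Game

/-- Index type of the left component `L_x`. -/
def LIdx : Game.{u} → Type u
  | mk α _ _ _ => α

/-- Index type of the right component `R_x`. -/
def RIdx : Game.{u} → Type u
  | mk _ β _ _ => β

/-- The members of `L_x`. -/
def left : (x : Game.{u}) → x.LIdx → Game.{u}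
  | mk _ _ L _ => L

/-- The members of `R_x`. -/
def right : (x : Game.{u}) → x.RIdx → Game.{u}
  | mk _ _ _ R => R

/-- `IsOption y x`: `y` is a member of `L_x` or of `R_x`. -/
inductive IsOption : Game.{u} → Game.{u} → Prop
  | ofLeft (x : Game.{u}) (i : x.LIdx) : IsOption (x.left i) x
  | ofRight (x : Game.{u}) (j : x.RIdx) : IsOption (x.right j) x

theorem wf_isOption : WellFounded IsOption.{u} := by
  refine ⟨fun x => ?_⟩
  induction x with
  | mk α β L R ihL ihR =>
    refine ⟨_, fun y h => ?_⟩
    cases h with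
    | ofLeft _ i => exact ihL i
    | ofRight _ j => exact ihR j

/-- Conway's comparison; its defining recursion is `Game.le_iff`. -/
instance : LE Game.{u} :=
  ⟨Sym2.GameAdd.recursion wf_isOption fun x y le =>
    (∀ i, ¬ le y (x.left i) (Sym2.GameAdd.snd_fst (IsOption.ofLeft x i))) ∧
      (∀ j, ¬ le (y.right j) x (Sym2.GameAdd.fst_snd (IsOption.ofRight y j)))⟩

/-- `x ≤ y` iff `y` is not `≤` any member of `L_x` and no member of `R_y` is `≤ x`. -/
theorem le_iff {x y : Game.{u}} :
    x ≤ y ↔ (∀ i, ¬ y ≤ x.left i) ∧ (∀ j, ¬ y.right j ≤ x) := Iff.of_eq <|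
  Sym2.GameAdd.recursion_eq wf_isOption
    (fun x y (le : ∀ a b : Game.{u}, Sym2.GameAdd IsOption s(a, b) s(x, y) → Prop) =>
      (∀ i, ¬ le y (x.left i) (Sym2.GameAdd.snd_fst (IsOption.ofLeft x i))) ∧
        (∀ j, ¬ le (y.right j) x (Sym2.GameAdd.fst_snd (IsOption.ofRight y j)))) x y

/-- Strict order. -/
instance : LT Game.{u} := ⟨fun x y => x ≤ y ∧ ¬ y ≤ x⟩

/-- The equivalence `x ≈ y`. -/
instance : HasEquiv Game.{u} := ⟨fun x y => x ≤ y ∧ y ≤ x⟩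

/-- `x` is a surreal number: all members of `L_x`, `R_x` are surreal numbers, and no member of
`R_x` is `≤` any member of `L_x`. -/
def IsSurreal : Game.{u} → Prop
  | mk _ _ L R => (∀ i j, ¬ R j ≤ L i) ∧ (∀ i, IsSurreal (L i)) ∧ (∀ j, IsSurreal (R j))

/-- `Identical x y`: `x` and `y` are equal when read as (hereditary) pairs of sets, i.e. every
member of `L_x` is identical to one of `L_y` and conversely, and likewise on the right. It is
finer than `≈`. -/
def Identical : Game.{u} → Game.{u} → Prop
  | mk _ _ L R, mk _ _ L' R' =>
    (∀ i, ∃ i', Identical (L i) (L' i')) ∧ (∀ i', ∃ i, Identical (L i) (L' i')) ∧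
      (∀ j, ∃ j', Identical (R j) (R' j')) ∧ (∀ j', ∃ j, Identical (R j) (R' j'))

/-! ### Ring operations -/

/-- `0 = { | }`. -/
instance : Zero Game.{u} := ⟨mk PEmpty PEmpty PEmpty.elim PEmpty.elim⟩

/-- `1 = {0 | }`. -/
instance : One Game.{u} := ⟨mk PUnit PEmpty (fun _ => 0) PEmpty.elim⟩

/-- `-x = {-x^R | -x^L}`. -/
def neg : Game.{u} → Game.{u}
  | mk α β L R => mk β α (fun j => neg (R j)) (fun i => neg (L i))

instance : Neg Game.{u} := ⟨neg⟩

/-- The map `y ↦ x + y`, given the maps `y ↦ x^L + y` and `y ↦ x^R + y`. -/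
def addAux {α β : Type u} (fL : α → Game.{u} → Game.{u}) (fR : β → Game.{u} → Game.{u}) :
    Game.{u} → Game.{u}
  | mk γ δ L R =>
    mk (α ⊕ γ) (β ⊕ δ)
      (Sum.elim (fun i => fL i (mk γ δ L R)) (fun k => addAux fL fR (L k)))
      (Sum.elim (fun j => fR j (mk γ δ L R)) (fun l => addAux fL fR (R l)))

/-- Addition; see `Game.mk_add_mk`. -/
def add : Game.{u} → Game.{u} → Game.{u}
  | mk _ _ L R => addAux (fun i => add (L i)) (fun j => add (R j))

instance : Add Game.{u} := ⟨add⟩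

instance : Sub Game.{u} := ⟨fun x y => x + -y⟩

/-- `x + y = {x^L + y, x + y^L | x^R + y, x + y^R}`. -/
theorem mk_add_mk {α β γ δ : Type u} (xL : α → Game.{u}) (xR : β → Game.{u})
    (yL : γ → Game.{u}) (yR : δ → Game.{u}) :
    mk α β xL xR + mk γ δ yL yR =
      mk (α ⊕ γ) (β ⊕ δ)
        (Sum.elim (fun i => xL i + mk γ δ yL yR) (fun k => mk α β xL xR + yL k))
        (Sum.elim (fun j => xR j + mk γ δ yL yR) (fun l => mk α β xL xR + yR l)) :=
  rfl

/-- The map `y ↦ x * y`, given the maps `y ↦ x^L * y` and `y ↦ x^R * y`. -/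
def mulAux {α β : Type u} (fL : α → Game.{u} → Game.{u}) (fR : β → Game.{u} → Game.{u}) :
    Game.{u} → Game.{u}
  | mk γ δ L R =>
    mk (α × γ ⊕ β × δ) (α × δ ⊕ β × γ)
      (Sum.elim
        (fun p => fL p.1 (mk γ δ L R) + mulAux fL fR (L p.2) - fL p.1 (L p.2))
        (fun p => fR p.1 (mk γ δ L R) + mulAux fL fR (R p.2) - fR p.1 (R p.2)))
      (Sum.elim
        (fun p => fL p.1 (mk γ δ L R) + mulAux fL fR (R p.2) - fL p.1 (R p.2))
        (fun p => fR p.1 (mk γ δ L R) + mulAux fL fR (L p.2) - fR p.1 (L p.2)))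

/-- Multiplication; see `Game.mk_mul_mk`. -/
def mul : Game.{u} → Game.{u} → Game.{u}
  | mk _ _ L R => mulAux (fun i => mul (L i)) (fun j => mul (R j))

instance : Mul Game.{u} := ⟨mul⟩

/-- `x y = {x^L y + x y^L - x^L y^L, x^R y + x y^R - x^R y^R |
x^L y + x y^R - x^L y^R, x^R y + x y^L - x^R y^L}`. -/
theorem mk_mul_mk {α β γ δ : Type u} (xL : α → Game.{u}) (xR : β → Game.{u})
    (yL : γ → Game.{u}) (yR : δ → Game.{u}) :
    mk α β xL xR * mk γ δ yL yR =
      mk (α × γ ⊕ β × δ) (α × δ ⊕ β × γ)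
        (Sum.elim
          (fun p => xL p.1 * mk γ δ yL yR + mk α β xL xR * yL p.2 - xL p.1 * yL p.2)
          (fun p => xR p.1 * mk γ δ yL yR + mk α β xL xR * yR p.2 - xR p.1 * yR p.2))
        (Sum.elim
          (fun p => xL p.1 * mk γ δ yL yR + mk α β xL xR * yR p.2 - xL p.1 * yR p.2)
          (fun p => xR p.1 * mk γ δ yL yR + mk α β xL xR * yL p.2 - xR p.1 * yL p.2)) :=
  rfl

/-! ### Small sets of games, presented as families -/

/-- A set of games, presented by a family over a small index type. -/
structure Fam : Type (u + 1) where
  /-- the index type -/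
  ι : Type u
  /-- the members -/
  val : ι → Game.{u}

namespace Fam

/-- `A ∪ B`. -/
def union (A B : Fam.{u}) : Fam.{u} := ⟨A.ι ⊕ B.ι, Sum.elim A.val B.val⟩

/-- The union of a sequence of sets. -/
def iUnion (A : ℕ → Fam.{u}) : Fam.{u} := ⟨Σ n, (A n).ι, fun p => (A p.1).val p.2⟩

end Fam

/-- The pair `{A | B}`. -/
def ofFam (A B : Fam.{u}) : Game.{u} := mk A.ι B.ι A.val B.val

/-! ### Inverse -/

/-- The set of all `(1 + (q - p) * y) * q⁻¹`, for `q` in the family `q : κ → Game`, whose inverses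
are given by `qinv`, and for `y ∈ Y`. -/
def invStep (p : Game.{u}) {κ : Type u} (q qinv : κ → Game.{u}) (Y : Fam.{u}) : Fam.{u} :=
  ⟨κ × Y.ι, fun s => (1 + (q s.1 - p) * Y.val s.2) * qinv s.1⟩

/-- The `n`-th left and right sets in the construction of the inverse of `p`; here `l`, `r` list
the positive members of `L_p`, `R_p`, and `linv`, `rinv` their inverses. -/
def invSeq (p : Game.{u}) {κ μ : Type u} (l linv : κ → Game.{u}) (r rinv : μ → Game.{u}) :
    ℕ → Fam.{u} × Fam.{u}
  | 0 => (⟨PUnit, fun _ => 0⟩, ⟨PEmpty, PEmpty.elim⟩)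
  | n + 1 =>
    let Y := invSeq p l linv r rinv n
    ((Y.1.union (invStep p r rinv Y.1)).union (invStep p l linv Y.2),
      (Y.2.union (invStep p l linv Y.1)).union (invStep p r rinv Y.2))

/-- Conway's inverse of a positive `x`. With `p = {0, x^L | x^R}`, where `x^L`, `x^R` are
restricted to positive members, it is the pair `y` generated by
`y = {0, (1 + (p^R - p) y^L) / p^R, (1 + (p^L - p) y^R) / p^L |
(1 + (p^L - p) y^L) / p^L, (1 + (p^R - p) y^R) / p^R}` with positive `p^L`, `p^R`. -/
def invPos : Game.{u} → Game.{u}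
  | mk α β L R =>
    let l : {i : α // 0 < L i} → Game.{u} := fun i => L i
    let r : {j : β // 0 < R j} → Game.{u} := fun j => R j
    let p : Game.{u} := mk (Option {i : α // 0 < L i}) {j : β // 0 < R j} (fun o => o.elim 0 l) r
    let Y := invSeq p l (fun i => invPos (L i)) r (fun j => invPos (R j))
    ofFam (Fam.iUnion fun n => (Y n).1) (Fam.iUnion fun n => (Y n).2)

open Classical in
/-- The inverse: Conway's for `x > 0`, `-(-x)⁻¹` for `x < 0`, and `0` otherwise. -/
instance : Inv Game.{u} :=
  ⟨fun x => if 0 < x then invPos x else if x < 0 then -invPos (-x) else 0⟩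

instance : Div Game.{u} := ⟨fun x y => x * y⁻¹⟩

/-! ### Square root -/

/-- `S(x, A, B)`: the set of all `(x + a * b) / (a + b)` with `a ∈ A`, `b ∈ B` and `¬ 0 ≈ a + b`. -/
def sqrtStep (x : Game.{u}) (A B : Fam.{u}) : Fam.{u} :=
  ⟨{s : A.ι × B.ι // ¬ 0 ≈ A.val s.1 + B.val s.2},
    fun s => (x + A.val s.1.1 * B.val s.1.2) / (A.val s.1.1 + B.val s.1.2)⟩

/-- The sequence of pairs `(L_n, R_n)` with `L_0 = A`, `R_0 = B`,
`L_{n+1} = L_n ∪ S(x, L_n, R_n)` and `R_{n+1} = R_n ∪ S(x, L_n, L_n) ∪ S(x, R_n, R_n)`. -/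
def sqrtSeq (x : Game.{u}) (A B : Fam.{u}) : ℕ → Fam.{u} × Fam.{u}
  | 0 => (A, B)
  | n + 1 =>
    let Y := sqrtSeq x A B n
    (Y.1.union (sqrtStep x Y.1 Y.2),
      (Y.2.union (sqrtStep x Y.1 Y.1)).union (sqrtStep x Y.2 Y.2))

/-- `√(x, A, B) = {⋃ L_n | ⋃ R_n}`. -/
def sqrtClosure (x : Game.{u}) (A B : Fam.{u}) : Game.{u} :=
  ofFam (Fam.iUnion fun n => (sqrtSeq x A B n).1) (Fam.iUnion fun n => (sqrtSeq x A B n).2)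

/-- Bach's square root:
`√x = √(x, {√x^L | 0 ≤ x^L ∈ L_x}, {√x^R | 0 ≤ x^R ∈ R_x})`. -/
def sqrt : Game.{u} → Game.{u}
  | mk α β L R =>
    sqrtClosure (mk α β L R)
      ⟨{i : α // 0 ≤ L i}, fun i => sqrt (L i)⟩
      ⟨{j : β // 0 ≤ R j}, fun j => sqrt (R j)⟩

/-- The pair `{ | a, b}` with empty left component and right component `{a, b}`. -/
def rightPair (a b : Game.{u}) : Game.{u} :=
  mk PEmpty (ULift.{u} Bool) PEmpty.elim (fun t => if t.down then b else a)

end Game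

end

/-! Everything is computed on values. Pairs modulo `≈` form an ordered abelian group `Value`, and
the values of surreal numbers form a linearly ordered field `Number`. `Rep x a` says that the pair
`x` is surreal with value `a`, so that a recursive construction can be studied through the values of
its options. The field structure rests on `isSurreal_mul_and_mulMono` (products of surreals are
surreal and respect `≈` and `<`) and on `Rep.exists_rep_invPos` (Conway's inverse).

For the square root of `x ≥ 0` with value `a`, the identity `sqrtStep_sq_sub`, namely `((a + cd)/(c
+ d))² - a = (a - c²)(a - d²)/(c + d)²`, shows by induction that all members of `L_n` have square
below `a` and all members of `R_n` square above `a`. Hence `√x` is a number `b ≥ 0`. A typical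
option `cb + bd - cd` of `b * b` lies below `a` exactly when `b < (a + cd)/(c + d)`, and that
quotient is itself an option of `√x` on the appropriate side. Therefore `b² = a` (`rep_sqrtClosure`,
`Rep.exists_rep_sqrt`), and the statements on `√(x x)` and on inverses follow because nonnegative
square roots in an ordered field are unique.

For `x < 0` all left options are negative, so every `L_n` is empty and the order condition on `√x`
is vacuous. The value of `√x` then depends on the right options listed. For `-1` the recursion
produces only `0` on the right. A redundant right option `z²` of `y ≈ -1` puts `0` and `z` into
`R_0`, hence `-1/z` into `R_1`, and `z = √(x² + 1) - x` makes this less than `-x`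
(`rightPair_spec`). -/

noncomputable section

namespace Game

/-! ### Options and order -/

/-- `Opt s z x`: `z` is a left (`s = true`) or right (`s = false`) option of `x`. -/
def Opt : Bool → Game.{u} → Game.{u} → Prop
  | true, z, x => ∃ i, x.left i = z
  | false, z, x => ∃ j, x.right j = z

theorem Opt.isOption {s : Bool} {z x : Game.{u}} (h : Opt s z x) : IsOption z x := by
  cases s <;> obtain ⟨i, rfl⟩ := h
  · exact .ofRight x i
  · exact .ofLeft x i

theorem optInduction {P : Game.{u} → Prop} (h : ∀ x, (∀ s z, Opt s z x → P z) → P x)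
    (x : Game.{u}) : P x :=
  wf_isOption.induction x fun x ih => h x fun _ _ hz => ih _ hz.isOption

theorem le_iff_opt {x y : Game.{u}} :
    x ≤ y ↔ (∀ z, Opt true z x → ¬ y ≤ z) ∧ (∀ z, Opt false z y → ¬ z ≤ x) := by
  rw [le_iff]
  simp [Opt]

theorem Opt.left_not_le {x y z : Game.{u}} (h : Opt true z x) (hxy : x ≤ y) : ¬ y ≤ z :=
  (le_iff_opt.1 hxy).1 z h

theorem Opt.right_not_le {x y z : Game.{u}} (h : Opt false z y) (hxy : x ≤ y) : ¬ z ≤ x :=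
  (le_iff_opt.1 hxy).2 z h

theorem game_le_refl (x : Game.{u}) : x ≤ x := by
  induction x using optInduction with
  | h x ih =>
    exact le_iff_opt.2 ⟨fun z hz h => hz.left_not_le h (ih _ z hz),
      fun z hz h => hz.right_not_le h (ih _ z hz)⟩

/-- Replacing a game in one instance of transitivity by an option produces a cyclic rotation of the
instance, so all three rotations are carried through the induction. -/
theorem game_le_trans_aux (x : Game.{u}) : ∀ y z : Game.{u},
    (x ≤ y → y ≤ z → x ≤ z) ∧ (y ≤ z → z ≤ x → y ≤ x) ∧ (z ≤ x → x ≤ y → z ≤ y) := by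
  have step : ∀ x y z : Game.{u}, (∀ x', Opt true x' x → y ≤ z → z ≤ x' → y ≤ x') →
      (∀ z', Opt false z' z → z' ≤ x → x ≤ y → z' ≤ y) → x ≤ y → y ≤ z → x ≤ z := by
    intro x y z h1 h2 hxy hyz
    exact le_iff_opt.2 ⟨fun x' hx' h => hx'.left_not_le hxy (h1 x' hx' hyz h),
      fun z' hz' h => hz'.right_not_le hyz (h2 z' hz' h hxy)⟩
  induction x using optInduction with
  | h x ihx =>
    intro y
    induction y using optInduction with
    | h y ihy =>
      intro z
      induction z using optInduction with
      | h z ihz =>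
        exact ⟨step x y z (fun x' h => (ihx _ x' h y z).2.1) (fun z' h => (ihz _ z' h).2.2),
          step y z x (fun y' h => (ihy _ y' h z).2.2) (fun x' h => (ihx _ x' h y z).1),
          step z x y (fun z' h => (ihz _ z' h).1) (fun y' h => (ihy _ y' h z).2.1)⟩

instance : Preorder Game.{u} where
  le_refl := game_le_refl
  le_trans x y z := (game_le_trans_aux x y z).1
  lt_iff_le_not_ge _ _ := Iff.rfl

theorem isSurreal_iff {x : Game.{u}} : x.IsSurreal ↔
    (∀ l r, Opt true l x → Opt false r x → ¬ r ≤ l) ∧ ∀ s z, Opt s z x → z.IsSurreal := by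
  cases x with
  | mk α β L R =>
    simp only [IsSurreal, Opt, Bool.forall_bool]
    constructor
    · rintro ⟨h1, h2, h3⟩
      exact ⟨by rintro _ _ ⟨i, rfl⟩ ⟨j, rfl⟩; exact h1 i j, by rintro _ ⟨j, rfl⟩; exact h3 j,
        by rintro _ ⟨i, rfl⟩; exact h2 i⟩
    · rintro ⟨h1, h3, h2⟩
      exact ⟨fun i j => h1 _ _ ⟨i, rfl⟩ ⟨j, rfl⟩, fun i => h2 _ ⟨i, rfl⟩, fun j => h3 _ ⟨j, rfl⟩⟩

theorem IsSurreal.opt {x : Game.{u}} (hx : x.IsSurreal) {s : Bool} {z : Game.{u}}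
    (h : Opt s z x) : z.IsSurreal :=
  (isSurreal_iff.1 hx).2 s z h

/-- If a left option `w` of a left option `z` satisfied `x ≤ w`, then `w ≤ z` by induction would
give `x ≤ z`, impossible for a left option. The other half of `z ≤ x` is the defining condition on
surreals. Right options are symmetric. -/
theorem IsSurreal.opt_le {x : Game.{u}} (hx : x.IsSurreal) :
    (∀ z, Opt true z x → z ≤ x) ∧ (∀ z, Opt false z x → x ≤ z) := by
  induction x using optInduction with
  | h x ih =>
    refine ⟨fun z hz => le_iff_opt.2 ⟨fun w hw h => ?_, fun w hw => (isSurreal_iff.1 hx).1 _ _ hz hw⟩,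
      fun z hz => le_iff_opt.2 ⟨fun w hw => (isSurreal_iff.1 hx).1 _ _ hw hz, fun w hw h => ?_⟩⟩
    · exact hz.left_not_le le_rfl (h.trans ((ih _ z hz (hx.opt hz)).1 w hw))
    · exact hz.right_not_le le_rfl (((ih _ z hz (hx.opt hz)).2 w hw).trans h)

theorem IsSurreal.left_lt {x z : Game.{u}} (hx : x.IsSurreal) (h : Opt true z x) : z < x :=
  ⟨hx.opt_le.1 z h, h.left_not_le le_rfl⟩

theorem IsSurreal.lt_right {x z : Game.{u}} (hx : x.IsSurreal) (h : Opt false z x) : x < z :=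
  ⟨hx.opt_le.2 z h, h.right_not_le le_rfl⟩

theorem exists_opt_of_not_le {x y : Game.{u}} (h : ¬ y ≤ x) :
    (∃ z, Opt false z x ∧ z ≤ y) ∨ (∃ z, Opt true z y ∧ x ≤ z) := by
  by_contra! hc
  exact h (le_iff_opt.2 ⟨fun z hz hxz => hc.2 z hz hxz, fun z hz hxz => hc.1 z hz hxz⟩)

theorem IsSurreal.le_total {x y : Game.{u}} (hx : x.IsSurreal) (hy : y.IsSurreal) :
    x ≤ y ∨ y ≤ x := by
  by_cases h : x ≤ y
  · exact .inl h
  · right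
    rcases exists_opt_of_not_le h with ⟨z, hz, h'⟩ | ⟨z, hz, h'⟩
    · exact (hy.lt_right hz).le.trans h'
    · exact h'.trans (hx.left_lt hz).le

theorem IsSurreal.not_le {x y : Game.{u}} (hx : x.IsSurreal) (hy : y.IsSurreal) :
    ¬ x ≤ y ↔ y < x :=
  ⟨fun h => ⟨(hx.le_total hy).resolve_left h, h⟩, fun h => h.2⟩

theorem IsSurreal.opt_lt_or_lt {x z : Game.{u}} (hx : x.IsSurreal) {s : Bool} (h : Opt s z x) :
    (s = true ∧ z < x) ∨ (s = false ∧ x < z) := by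
  cases s
  · exact .inr ⟨rfl, hx.lt_right h⟩
  · exact .inl ⟨rfl, hx.left_lt h⟩

/-! ### Options of compound games -/

theorem opt_zero {s : Bool} {z : Game.{u}} : ¬ Opt s z 0 := by
  cases s <;> rintro ⟨⟨⟩, _⟩

theorem opt_one {s : Bool} {z : Game.{u}} : Opt s z 1 ↔ s = true ∧ z = 0 := by
  cases s
  · exact ⟨by rintro ⟨⟨⟩, _⟩, by simp⟩
  · exact ⟨by rintro ⟨_, rfl⟩; exact ⟨rfl, rfl⟩, by rintro ⟨_, rfl⟩; exact ⟨⟨⟩, rfl⟩⟩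

theorem opt_neg {s : Bool} {z x : Game.{u}} : Opt s z (-x) ↔ ∃ x', Opt (!s) x' x ∧ z = -x' := by
  cases x with
  | mk α β L R =>
    cases s
    · exact ⟨by rintro ⟨i, rfl⟩; exact ⟨_, ⟨i, rfl⟩, rfl⟩, by rintro ⟨_, ⟨i, rfl⟩, rfl⟩; exact ⟨i, rfl⟩⟩
    · exact ⟨by rintro ⟨i, rfl⟩; exact ⟨_, ⟨i, rfl⟩, rfl⟩, by rintro ⟨_, ⟨i, rfl⟩, rfl⟩; exact ⟨i, rfl⟩⟩

theorem opt_add {s : Bool} {z x y : Game.{u}} : Opt s z (x + y) ↔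
    (∃ x', Opt s x' x ∧ z = x' + y) ∨ (∃ y', Opt s y' y ∧ z = x + y') := by
  cases x with
  | mk α β L R =>
    cases y with
    | mk γ δ L' R' =>
      cases s
      all_goals
        constructor
        · rintro ⟨i | i, rfl⟩
          · exact .inl ⟨_, ⟨i, rfl⟩, rfl⟩
          · exact .inr ⟨_, ⟨i, rfl⟩, rfl⟩
        · rintro (⟨_, ⟨i, rfl⟩, rfl⟩ | ⟨_, ⟨i, rfl⟩, rfl⟩)
          · exact ⟨.inl i, rfl⟩
          · exact ⟨.inr i, rfl⟩

/-- The side `t == s` encodes the sign rule: left options of a product come from equal sides, right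
options from opposite sides. This lets the four kinds of option be handled uniformly. -/
theorem opt_mul {s : Bool} {z x y : Game.{u}} : Opt s z (x * y) ↔
    ∃ t x' y', Opt t x' x ∧ Opt (t == s) y' y ∧ z = x' * y + x * y' - x' * y' := by
  cases x with
  | mk α β L R =>
    cases y with
    | mk γ δ L' R' =>
      cases s
      · constructor
        · rintro ⟨⟨i, j⟩ | ⟨i, j⟩, rfl⟩
          · exact ⟨true, _, _, ⟨i, rfl⟩, ⟨j, rfl⟩, rfl⟩
          · exact ⟨false, _, _, ⟨i, rfl⟩, ⟨j, rfl⟩, rfl⟩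
        · rintro ⟨_ | _, _, _, ⟨i, rfl⟩, ⟨j, rfl⟩, rfl⟩
          · exact ⟨.inr (i, j), rfl⟩
          · exact ⟨.inl (i, j), rfl⟩
      · constructor
        · rintro ⟨⟨i, j⟩ | ⟨i, j⟩, rfl⟩
          · exact ⟨true, _, _, ⟨i, rfl⟩, ⟨j, rfl⟩, rfl⟩
          · exact ⟨false, _, _, ⟨i, rfl⟩, ⟨j, rfl⟩, rfl⟩
        · rintro ⟨_ | _, _, _, ⟨i, rfl⟩, ⟨j, rfl⟩, rfl⟩
          · exact ⟨.inr (i, j), rfl⟩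
          · exact ⟨.inl (i, j), rfl⟩

theorem game_neg_neg (x : Game.{u}) : - -x = x := by
  induction x with
  | mk α β L R ihL ihR => exact congrArg₂ (mk α β) (funext ihL) (funext ihR)

/-- Unfolding either equivalence calls the other one at an option, hence the conjunction. -/
theorem game_neg_le_neg_iff (x : Game.{u}) : ∀ y : Game.{u}, (-x ≤ -y ↔ y ≤ x) ∧ (-y ≤ -x ↔ x ≤ y) := by
  induction x using optInduction with
  | h x ihx =>
    intro y
    induction y using optInduction with
    | h y ihy =>
      constructor
      · rw [le_iff_opt, le_iff_opt (x := y), and_comm]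
        simp only [opt_neg]
        refine and_congr ⟨fun h z hz h' => h _ ⟨z, hz, rfl⟩ ((ihy _ z hz).2.2 h'), ?_⟩
          ⟨fun h z hz h' => h _ ⟨z, hz, rfl⟩ ((ihx _ z hz y).2.2 h'), ?_⟩
        · rintro h _ ⟨z, hz, rfl⟩ h'
          exact h z hz ((ihy _ z hz).2.1 h')
        · rintro h _ ⟨z, hz, rfl⟩ h'
          exact h z hz ((ihx _ z hz y).2.1 h')
      · rw [le_iff_opt, le_iff_opt (x := x), and_comm]
        simp only [opt_neg]
        refine and_congr ⟨fun h z hz h' => h _ ⟨z, hz, rfl⟩ ((ihx _ z hz y).1.2 h'), ?_⟩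
          ⟨fun h z hz h' => h _ ⟨z, hz, rfl⟩ ((ihy _ z hz).1.2 h'), ?_⟩
        · rintro h _ ⟨z, hz, rfl⟩ h'
          exact h z hz ((ihx _ z hz y).1.1 h')
        · rintro h _ ⟨z, hz, rfl⟩ h'
          exact h z hz ((ihy _ z hz).1.1 h')

/-- Monotonicity and cancellation are proved together: each handles the options of `y` and `z` by
the other. For an option `x'` of `x`, induction gives `x' + y ≤ x' + z`, which rules out `x + z ≤ x'
+ y` when `x'` is a left option, and `x' + z ≤ x + y` when it is a right one. -/
theorem game_add_le_add_iff (x : Game.{u}) : ∀ y z : Game.{u},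
    (x + y ≤ x + z ↔ y ≤ z) ∧ (x + z ≤ x + y ↔ z ≤ y) := by
  have step : ∀ x y z : Game.{u}, (∀ s x', Opt s x' x → y ≤ z → x' + y ≤ x' + z) →
      (∀ y', Opt true y' y → (x + z ≤ x + y' ↔ z ≤ y')) →
      (∀ z', Opt false z' z → (x + z' ≤ x + y ↔ z' ≤ y)) → (x + y ≤ x + z ↔ y ≤ z) := by
    intro x y z h1 h2 h3
    constructor
    · intro h
      refine le_iff_opt.2 ⟨fun y' hy' h' => ?_, fun z' hz' h' => ?_⟩
      · exact (opt_add.2 (.inr ⟨y', hy', rfl⟩)).left_not_le h ((h2 y' hy').2 h')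
      · exact (opt_add.2 (.inr ⟨z', hz', rfl⟩)).right_not_le h ((h3 z' hz').2 h')
    · intro h
      refine le_iff_opt.2 ⟨fun w hw h' => ?_, fun w hw h' => ?_⟩
      · rcases opt_add.1 hw with ⟨x', hx', rfl⟩ | ⟨y', hy', rfl⟩
        · exact (opt_add.2 (.inl ⟨x', hx', rfl⟩)).left_not_le le_rfl (h'.trans (h1 _ x' hx' h))
        · exact hy'.left_not_le h ((h2 y' hy').1 h')
      · rcases opt_add.1 hw with ⟨x', hx', rfl⟩ | ⟨z', hz', rfl⟩
        · exact (opt_add.2 (.inl ⟨x', hx', rfl⟩)).right_not_le le_rfl ((h1 _ x' hx' h).trans h')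
        · exact hz'.right_not_le h ((h3 z' hz').1 h')
  induction x using optInduction with
  | h x ihx =>
    intro y
    induction y using optInduction with
    | h y ihy =>
      intro z
      induction z using optInduction with
      | h z ihz =>
        exact ⟨step x y z (fun s x' h => (ihx s x' h y z).1.2) (fun y' h => (ihy _ y' h z).2)
            (fun z' h => (ihz _ z' h).2),
          step x z y (fun s x' h => (ihx s x' h y z).2.2) (fun z' h => (ihz _ z' h).1)
            (fun y' h => (ihy _ y' h z).1)⟩

/-! ### The ordered group of games up to equivalence -/

/-- The equivalence `≈` as a setoid. -/
def gameSetoid : Setoid Game.{u} where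
  r x y := x ≈ y
  iseqv := ⟨fun _ => ⟨le_rfl, le_rfl⟩, fun h => ⟨h.2, h.1⟩,
    fun h h' => ⟨h.1.trans h'.1, h'.2.trans h.2⟩⟩

/-- Games up to `≈`. -/
def Value : Type (u + 1) := Quotient gameSetoid.{u}

/-- The value of a game. -/
def cls (x : Game.{u}) : Value.{u} := Quotient.mk gameSetoid x

theorem cls_eq {x y : Game.{u}} : cls x = cls y ↔ x ≈ y :=
  ⟨fun h => Quotient.exact h, fun h => Quotient.sound (s := gameSetoid) h⟩

instance : PartialOrder Value.{u} where
  le := Quotient.lift₂ (· ≤ ·) fun _ _ _ _ h h' =>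
    propext ⟨fun H => h.2.trans (H.trans h'.1), fun H => h.1.trans (H.trans h'.2)⟩
  le_refl := by rintro ⟨x⟩; exact le_refl x
  le_trans := by rintro ⟨x⟩ ⟨y⟩ ⟨z⟩; exact le_trans (α := Game)
  le_antisymm := by rintro ⟨x⟩ ⟨y⟩ h h'; exact cls_eq.2 ⟨h, h'⟩

theorem cls_le {x y : Game.{u}} : cls x ≤ cls y ↔ x ≤ y := Iff.rfl

theorem cls_lt {x y : Game.{u}} : cls x < cls y ↔ x < y := by
  rw [lt_iff_le_not_ge, cls_le, cls_le]; rfl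

/-- The tool for the group and ring identities: matching options up to `≈` suffices, and the values
of matching options agree by the induction hypotheses and additive algebra. -/
theorem cls_eq_of_opt {x y : Game.{u}} (h : ∀ s z, Opt s z x → ∃ w, Opt s w y ∧ cls z = cls w)
    (h' : ∀ s z, Opt s z y → ∃ w, Opt s w x ∧ cls w = cls z) : cls x = cls y := by
  refine cls_eq.2 ⟨le_iff_opt.2 ⟨fun z hz hl => ?_, fun z hz hl => ?_⟩,
    le_iff_opt.2 ⟨fun z hz hl => ?_, fun z hz hl => ?_⟩⟩
  · obtain ⟨w, hw, e⟩ := h _ _ hz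
    exact hw.left_not_le le_rfl (hl.trans (cls_eq.1 e).1)
  · obtain ⟨w, hw, e⟩ := h' _ _ hz
    exact hw.right_not_le le_rfl ((cls_eq.1 e).1.trans hl)
  · obtain ⟨w, hw, e⟩ := h' _ _ hz
    exact hw.left_not_le le_rfl (hl.trans (cls_eq.1 e).2)
  · obtain ⟨w, hw, e⟩ := h _ _ hz
    exact hw.right_not_le le_rfl ((cls_eq.1 e).2.trans hl)

theorem game_add_comm (x : Game.{u}) : ∀ y, cls (x + y) = cls (y + x) := by
  induction x using optInduction with
  | h x ihx =>
    intro y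
    induction y using optInduction with
    | h y ihy =>
      refine cls_eq_of_opt ?_ ?_
      · intro s z hz
        rcases opt_add.1 hz with ⟨x', hx', rfl⟩ | ⟨y', hy', rfl⟩
        · exact ⟨_, opt_add.2 (.inr ⟨x', hx', rfl⟩), ihx s x' hx' y⟩
        · exact ⟨_, opt_add.2 (.inl ⟨y', hy', rfl⟩), ihy s y' hy'⟩
      · intro s z hz
        rcases opt_add.1 hz with ⟨x', hx', rfl⟩ | ⟨y', hy', rfl⟩
        · exact ⟨_, opt_add.2 (.inr ⟨x', hx', rfl⟩), ihy s x' hx'⟩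
        · exact ⟨_, opt_add.2 (.inl ⟨y', hy', rfl⟩), ihx s y' hy' y⟩

theorem game_add_assoc (x : Game.{u}) : ∀ y z, cls (x + y + z) = cls (x + (y + z)) := by
  induction x using optInduction with
  | h x ihx =>
    intro y
    induction y using optInduction with
    | h y ihy =>
      intro z
      induction z using optInduction with
      | h z ihz =>
        refine cls_eq_of_opt ?_ ?_
        · intro s w hw
          rcases opt_add.1 hw with ⟨_, h, rfl⟩ | ⟨z', hz', rfl⟩
          · rcases opt_add.1 h with ⟨x', hx', rfl⟩ | ⟨y', hy', rfl⟩
            · exact ⟨_, opt_add.2 (.inl ⟨x', hx', rfl⟩), ihx s x' hx' y z⟩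
            · exact ⟨_, opt_add.2 (.inr ⟨_, opt_add.2 (.inl ⟨y', hy', rfl⟩), rfl⟩), ihy s y' hy' z⟩
          · exact ⟨_, opt_add.2 (.inr ⟨_, opt_add.2 (.inr ⟨z', hz', rfl⟩), rfl⟩), ihz s z' hz'⟩
        · intro s w hw
          rcases opt_add.1 hw with ⟨x', hx', rfl⟩ | ⟨_, h, rfl⟩
          · exact ⟨_, opt_add.2 (.inl ⟨_, opt_add.2 (.inl ⟨x', hx', rfl⟩), rfl⟩), ihx s x' hx' y z⟩
          · rcases opt_add.1 h with ⟨y', hy', rfl⟩ | ⟨z', hz', rfl⟩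
            · exact ⟨_, opt_add.2 (.inl ⟨_, opt_add.2 (.inr ⟨y', hy', rfl⟩), rfl⟩), ihy s y' hy' z⟩
            · exact ⟨_, opt_add.2 (.inr ⟨z', hz', rfl⟩), ihz s z' hz'⟩

theorem game_zero_add (x : Game.{u}) : cls (0 + x) = cls x := by
  induction x using optInduction with
  | h x ih =>
    refine cls_eq_of_opt ?_ fun s z hz => ⟨_, opt_add.2 (.inr ⟨z, hz, rfl⟩), ih s z hz⟩
    intro s z hz
    rcases opt_add.1 hz with ⟨_, h, _⟩ | ⟨x', hx', rfl⟩
    · exact (opt_zero h).elim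
    · exact ⟨x', hx', ih s x' hx'⟩

/-- The mirror strategy: a move in one summand is answered by the corresponding move in the other,
leaving `-x' + x'`. -/
theorem game_neg_add (x : Game.{u}) : cls (-x + x) = cls 0 := by
  induction x using optInduction with
  | h x ih =>
    have key : ∀ s z, Opt s z (-x + x) → ∃ w, Opt (!s) w z ∧ cls w = cls 0 := by
      intro s z hz
      rcases opt_add.1 hz with ⟨_, h, rfl⟩ | ⟨x', hx', rfl⟩
      · obtain ⟨x', hx', rfl⟩ := opt_neg.1 h
        exact ⟨_, opt_add.2 (.inr ⟨x', hx', rfl⟩), ih _ x' hx'⟩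
      · exact ⟨_, opt_add.2 (.inl ⟨_, opt_neg.2 ⟨x', by simpa using hx', rfl⟩, rfl⟩), ih _ x' hx'⟩
    refine cls_eq.2 ⟨le_iff_opt.2 ⟨fun z hz h => ?_, fun z hz => (opt_zero hz).elim⟩,
      le_iff_opt.2 ⟨fun z hz => (opt_zero hz).elim, fun z hz h => ?_⟩⟩
    · obtain ⟨w, hw, e⟩ := key _ z hz
      exact hw.right_not_le h (cls_eq.1 e).1
    · obtain ⟨w, hw, e⟩ := key _ z hz
      exact hw.left_not_le h (cls_eq.1 e).2

theorem cls_add_congr {x x' y y' : Game.{u}} (h : cls x = cls x') (h' : cls y = cls y') :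
    cls (x + y) = cls (x' + y') := by
  have H : ∀ x y y' : Game.{u}, cls y = cls y' → cls (x + y) = cls (x + y') := fun x y y' h =>
    cls_eq.2 ⟨(game_add_le_add_iff x y y').1.2 (cls_eq.1 h).1,
      (game_add_le_add_iff x y y').2.2 (cls_eq.1 h).2⟩
  rw [H x y y' h', game_add_comm, H y' x x' h, game_add_comm]

instance : Add Value.{u} :=
  ⟨Quotient.lift₂ (fun x y => cls (x + y)) fun _ _ _ _ h h' =>
    cls_add_congr (cls_eq.2 h) (cls_eq.2 h')⟩

instance : Zero Value.{u} := ⟨cls 0⟩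

instance : Neg Value.{u} :=
  ⟨Quotient.lift (fun x => cls (-x)) fun x y h =>
    cls_eq.2 ⟨(game_neg_le_neg_iff x y).1.2 h.2, (game_neg_le_neg_iff x y).2.2 h.1⟩⟩

theorem cls_surjective : Function.Surjective cls.{u} := Quotient.exists_rep

theorem cls_add (x y : Game.{u}) : cls (x + y) = cls x + cls y := rfl
theorem cls_neg (x : Game.{u}) : cls (-x) = -cls x := rfl

instance : AddCommGroup Value.{u} where
  add_assoc := by
    simp only [cls_surjective.forall]; exact game_add_assoc
  zero_add := by simp only [cls_surjective.forall]; exact game_zero_add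
  add_zero := by
    simp only [cls_surjective.forall]
    exact fun x => (game_add_comm x 0).trans (game_zero_add x)
  add_comm := by simp only [cls_surjective.forall]; exact game_add_comm
  neg_add_cancel := by simp only [cls_surjective.forall]; exact game_neg_add
  nsmul := nsmulRec
  zsmul := zsmulRec

theorem cls_sub (x y : Game.{u}) : cls (x - y) = cls x - cls y :=
  (cls_add x (-y)).trans (by rw [cls_neg, sub_eq_add_neg])

instance : IsOrderedAddMonoid Value.{u} where
  add_le_add_left := by
    simp only [cls_surjective.forall]
    intro x y h z
    rw [add_comm, add_comm (cls y)]
    exact (game_add_le_add_iff z x y).1.2 h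

/-! ### Closure of the surreal numbers under the additive operations -/

theorem isSurreal_zero : IsSurreal (0 : Game.{u}) :=
  isSurreal_iff.2 ⟨fun _ _ h => (opt_zero h).elim, fun _ _ h => (opt_zero h).elim⟩

theorem isSurreal_one : IsSurreal (1 : Game.{u}) :=
  isSurreal_iff.2 ⟨fun _ _ _ h => by simpa using (opt_one.1 h).1,
    fun _ _ h => (opt_one.1 h).2 ▸ isSurreal_zero⟩

theorem IsSurreal.neg {x : Game.{u}} (hx : x.IsSurreal) : (-x).IsSurreal := by
  induction x using optInduction with
  | h x ih =>
    refine isSurreal_iff.2 ⟨fun l r hl hr h => ?_, fun s z hz => ?_⟩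
    · obtain ⟨l, hl', rfl⟩ := opt_neg.1 hl
      obtain ⟨r, hr', rfl⟩ := opt_neg.1 hr
      exact (isSurreal_iff.1 hx).1 _ _ hr' hl' ((game_neg_le_neg_iff r l).1.1 h)
    · obtain ⟨z, hz', rfl⟩ := opt_neg.1 hz
      exact ih _ z hz' (hx.opt hz')

theorem IsSurreal.add {x y : Game.{u}} (hx : x.IsSurreal) (hy : y.IsSurreal) :
    (x + y).IsSurreal := by
  induction x using optInduction generalizing y with
  | h x ihx =>
    induction y using optInduction with
    | h y ihy =>
      refine isSurreal_iff.2 ⟨fun l r hl hr h => ?_, fun s z hz => ?_⟩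
      · refine (lt_irrefl (cls l)) (lt_of_lt_of_le ?_ (cls_le.2 h))
        rcases opt_add.1 hl with ⟨l, hl', rfl⟩ | ⟨l, hl', rfl⟩ <;>
          rcases opt_add.1 hr with ⟨r, hr', rfl⟩ | ⟨r, hr', rfl⟩ <;> simp only [cls_add]
        · exact add_lt_add_left (cls_lt.2 ((hx.left_lt hl').trans (hx.lt_right hr'))) _
        · exact add_lt_add (cls_lt.2 (hx.left_lt hl')) (cls_lt.2 (hy.lt_right hr'))
        · exact add_lt_add (cls_lt.2 (hx.lt_right hr')) (cls_lt.2 (hy.left_lt hl'))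
        · exact add_lt_add_right (cls_lt.2 ((hy.left_lt hl').trans (hy.lt_right hr'))) _
      · rcases opt_add.1 hz with ⟨z, h, rfl⟩ | ⟨z, h, rfl⟩
        · exact ihx _ z h (hx.opt h) hy
        · exact ihy _ z h (hy.opt h)

theorem IsSurreal.sub {x y : Game.{u}} (hx : x.IsSurreal) (hy : y.IsSurreal) :
    (x - y).IsSurreal :=
  hx.add hy.neg

/-! ### Ring identities for the values of products -/

/-- This and the following ring identities hold for all games. They never replace a factor by an
equivalent one, so the compatibility of multiplication with `≈`, proved below for surreals only, is
not needed. -/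
theorem game_mul_comm (x : Game.{u}) : ∀ y, cls (x * y) = cls (y * x) := by
  induction x using optInduction with
  | h x ihx =>
    intro y
    induction y using optInduction with
    | h y ihy =>
      have key : ∀ s t x' y', Opt s x' x → Opt t y' y →
          cls (x' * y + x * y' - x' * y') = cls (y' * x + y * x' - y' * x') := by
        intro s t x' y' hx hy
        simp only [cls_add, cls_sub, ihx _ _ hx, ihy _ _ hy]
        abel
      refine cls_eq_of_opt ?_ ?_
      · intro s z hz
        obtain ⟨t, x', y', hx, hy, rfl⟩ := opt_mul.1 hz
        exact ⟨_, opt_mul.2 ⟨_, y', x', hy, by cases s <;> cases t <;> exact hx, rfl⟩,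
          key _ _ _ _ hx hy⟩
      · intro s z hz
        obtain ⟨t, y', x', hy, hx, rfl⟩ := opt_mul.1 hz
        exact ⟨_, opt_mul.2 ⟨_, x', y', hx, by cases s <;> cases t <;> exact hy, rfl⟩,
          key _ _ _ _ hx hy⟩

theorem game_zero_mul (x : Game.{u}) : cls (0 * x) = 0 := by
  refine cls_eq_of_opt (y := 0) (fun s z hz => ?_) fun s z hz => (opt_zero hz).elim
  obtain ⟨_, _, _, h, _⟩ := opt_mul.1 hz
  exact (opt_zero h).elim

theorem game_one_mul (x : Game.{u}) : cls (1 * x) = cls x := by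
  induction x using optInduction with
  | h x ih =>
    have key : ∀ s x', Opt s x' x → cls (0 * x + 1 * x' - 0 * x') = cls x' := by
      intro s x' h
      simp [cls_add, cls_sub, game_zero_mul, ih _ _ h]
    refine cls_eq_of_opt (fun s z hz => ?_) fun s z hz =>
      ⟨_, opt_mul.2 ⟨true, 0, z, opt_one.2 ⟨rfl, rfl⟩, by simpa using hz, rfl⟩, key _ _ hz⟩
    obtain ⟨t, _, x', h, hx, rfl⟩ := opt_mul.1 hz
    obtain ⟨rfl, rfl⟩ := opt_one.1 h
    exact ⟨x', by simpa using hx, key _ _ hx⟩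

theorem game_neg_mul (x : Game.{u}) : ∀ y, cls (-x * y) = -cls (x * y) := by
  induction x using optInduction with
  | h x ihx =>
    intro y
    induction y using optInduction with
    | h y ihy =>
      have key : ∀ s t x' y', Opt s x' x → Opt t y' y →
          cls (-x' * y + -x * y' - -x' * y') = cls (-(x' * y + x * y' - x' * y')) := by
        intro s t x' y' hx hy
        simp only [cls_add, cls_sub, cls_neg, ihx _ _ hx, ihy _ _ hy]
        abel
      rw [← cls_neg]
      refine cls_eq_of_opt ?_ ?_
      · intro s z hz
        obtain ⟨t, _, y', h, hy, rfl⟩ := opt_mul.1 hz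
        obtain ⟨x', hx, rfl⟩ := opt_neg.1 h
        exact ⟨_, opt_neg.2 ⟨_, opt_mul.2 ⟨_, x', y', hx, by cases s <;> cases t <;> exact hy, rfl⟩,
          rfl⟩, key _ _ _ _ hx hy⟩
      · intro s z hz
        obtain ⟨_, h, rfl⟩ := opt_neg.1 hz
        obtain ⟨t, x', y', hx, hy, rfl⟩ := opt_mul.1 h
        exact ⟨_, opt_mul.2 ⟨!t, -x', y', opt_neg.2 ⟨x', by simpa using hx, rfl⟩,
          by cases s <;> cases t <;> exact hy, rfl⟩, key _ _ _ _ hx hy⟩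

theorem game_mul_add (x : Game.{u}) :
    ∀ y z, cls (x * (y + z)) = cls (x * y) + cls (x * z) := by
  induction x using optInduction with
  | h x ihx =>
    intro y
    induction y using optInduction with
    | h y ihy =>
      intro z
      induction z using optInduction with
      | h z ihz =>
        have key₁ : ∀ s t x' y', Opt s x' x → Opt t y' y →
            cls (x' * (y + z) + x * (y' + z) - x' * (y' + z)) =
              cls (x' * y + x * y' - x' * y' + x * z) := by
          intro s t x' y' hx hy
          simp only [cls_add, cls_sub, ihx _ _ hx, ihy _ _ hy]
          abel
        have key₂ : ∀ s t x' z', Opt s x' x → Opt t z' z →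
            cls (x' * (y + z) + x * (y + z') - x' * (y + z')) =
              cls (x * y + (x' * z + x * z' - x' * z')) := by
          intro s t x' y' hx hy
          simp only [cls_add, cls_sub, ihx _ _ hx, ihz _ _ hy]
          abel
        rw [← cls_add]
        refine cls_eq_of_opt ?_ ?_
        · intro s w hw
          obtain ⟨t, x', _, hx, h, rfl⟩ := opt_mul.1 hw
          rcases opt_add.1 h with ⟨y', hy, rfl⟩ | ⟨z', hz, rfl⟩
          · exact ⟨_, opt_add.2 (.inl ⟨_, opt_mul.2 ⟨t, x', y', hx, hy, rfl⟩, rfl⟩),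
              key₁ _ _ _ _ hx hy⟩
          · exact ⟨_, opt_add.2 (.inr ⟨_, opt_mul.2 ⟨t, x', z', hx, hz, rfl⟩, rfl⟩),
              key₂ _ _ _ _ hx hz⟩
        · intro s w hw
          rcases opt_add.1 hw with ⟨_, h, rfl⟩ | ⟨_, h, rfl⟩
          · obtain ⟨t, x', y', hx, hy, rfl⟩ := opt_mul.1 h
            exact ⟨_, opt_mul.2 ⟨t, x', _, hx, opt_add.2 (.inl ⟨y', hy, rfl⟩), rfl⟩,
              key₁ _ _ _ _ hx hy⟩
          · obtain ⟨t, x', z', hx, hz, rfl⟩ := opt_mul.1 h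
            exact ⟨_, opt_mul.2 ⟨t, x', _, hx, opt_add.2 (.inr ⟨z', hz, rfl⟩), rfl⟩,
              key₂ _ _ _ _ hx hz⟩

theorem game_add_mul (x y z : Game.{u}) : cls ((x + y) * z) = cls (x * z) + cls (y * z) := by
  rw [game_mul_comm, game_mul_add, game_mul_comm z, game_mul_comm z]

theorem game_mul_neg (x y : Game.{u}) : cls (x * -y) = -cls (x * y) := by
  rw [game_mul_comm, game_neg_mul, game_mul_comm]

theorem game_mul_sub (x y z : Game.{u}) : cls (x * (y - z)) = cls (x * y) - cls (x * z) := by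
  rw [sub_eq_add_neg, ← game_mul_neg]
  exact game_mul_add x y (-z)

theorem game_sub_mul (x y z : Game.{u}) : cls ((x - y) * z) = cls (x * z) - cls (y * z) := by
  rw [game_mul_comm, game_mul_sub, game_mul_comm z, game_mul_comm z]

theorem game_mul_assoc (x : Game.{u}) : ∀ y z, cls (x * y * z) = cls (x * (y * z)) := by
  induction x using optInduction with
  | h x ihx =>
    intro y
    induction y using optInduction with
    | h y ihy =>
      intro z
      induction z using optInduction with
      | h z ihz =>
        have key : ∀ s t r x' y' z', Opt s x' x → Opt t y' y → Opt r z' z →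
            cls ((x' * y + x * y' - x' * y') * z + x * y * z' - (x' * y + x * y' - x' * y') * z') =
            cls (x' * (y * z) + x * (y' * z + y * z' - y' * z') -
              x' * (y' * z + y * z' - y' * z')) := by
          intro s t r x' y' z' hx hy hz
          simp only [cls_add, cls_sub, game_mul_add, game_mul_sub, game_add_mul, game_sub_mul,
            ihx _ _ hx, ihy _ _ hy, ihz _ _ hz]
          abel
        refine cls_eq_of_opt ?_ ?_
        · intro s w hw
          obtain ⟨t, _, z', h, hz, rfl⟩ := opt_mul.1 hw
          obtain ⟨r, x', y', hx, hy, rfl⟩ := opt_mul.1 h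
          exact ⟨_, opt_mul.2 ⟨r, x', _, hx, opt_mul.2 ⟨_, y', z', hy,
            by cases s <;> cases t <;> cases r <;> exact hz, rfl⟩, rfl⟩, key _ _ _ _ _ _ hx hy hz⟩
        · intro s w hw
          obtain ⟨t, x', _, hx, h, rfl⟩ := opt_mul.1 hw
          obtain ⟨r, y', z', hy, hz, rfl⟩ := opt_mul.1 h
          exact ⟨_, opt_mul.2 ⟨t == r, _, z', opt_mul.2 ⟨t, x', y', hx,
            by cases t <;> cases r <;> exact hy, rfl⟩,
            by cases s <;> cases t <;> cases r <;> exact hz, rfl⟩, key _ _ _ _ _ _ hx hy hz⟩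

/-! ### Products of surreal numbers -/

/-- The value of the formal product `(x₂ - x₁) (y₂ - y₁)`. -/
def crossDiff (x₁ x₂ y₁ y₂ : Game.{u}) : Value.{u} :=
  cls (x₁ * y₁) + cls (x₂ * y₂) - cls (x₁ * y₂) - cls (x₂ * y₁)

theorem crossDiff_comm (x₁ x₂ y₁ y₂ : Game.{u}) : crossDiff x₁ x₂ y₁ y₂ = crossDiff y₁ y₂ x₁ x₂ := by
  simp only [crossDiff, game_mul_comm x₁, game_mul_comm x₂]
  abel

theorem crossDiff_add (x₁ x₂ x₃ y₁ y₂ : Game.{u}) :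
    crossDiff x₁ x₂ y₁ y₂ + crossDiff x₂ x₃ y₁ y₂ = crossDiff x₁ x₃ y₁ y₂ := by
  simp only [crossDiff]
  abel

/-- Multiplication by `y` respects `≈` on `x₁`, `x₂`, and `(x₂ - x₁) (y₂ - y₁)` is positive when
`x₁ < x₂` and one of `y₁ < y₂` is `y` and the other an option of `y`. -/
def MulMono (x₁ x₂ y : Game.{u}) : Prop :=
  (x₁ ≈ x₂ → cls (x₁ * y) = cls (x₂ * y)) ∧
    (x₁ < x₂ → ∀ s y', Opt s y' y →
      (y' < y → 0 < crossDiff x₁ x₂ y' y) ∧ (y < y' → 0 < crossDiff x₁ x₂ y y'))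

/-- Up to sign each cross difference is `x y - (x' y + x y' - x' y')`, so its positivity says that
the surreal `x * y` lies strictly on the correct side of its option. -/
theorem IsSurreal.crossDiff_pos {x y x' y' : Game.{u}} (hx : x.IsSurreal) (hy : y.IsSurreal)
    (hxy : (x * y).IsSurreal) {s t : Bool} (hx' : Opt s x' x) (hy' : Opt t y' y) :
    (x' < x → y' < y → 0 < crossDiff x' x y' y) ∧ (x' < x → y < y' → 0 < crossDiff x' x y y') ∧
    (x < x' → y' < y → 0 < crossDiff x x' y' y) ∧ (x < x' → y < y' → 0 < crossDiff x x' y y') := by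
  rcases hx.opt_lt_or_lt hx' with ⟨rfl, h⟩ | ⟨rfl, h⟩ <;>
    rcases hy.opt_lt_or_lt hy' with ⟨rfl, h'⟩ | ⟨rfl, h'⟩ <;>
    simp only [h, h', h.not_gt, h'.not_gt, forall_const, false_imp_iff, true_and, and_true,
      implies_true, and_self, crossDiff]
  · have := cls_lt.2 (hxy.left_lt (opt_mul.2 ⟨true, x', y', hx', hy', rfl⟩))
    simp only [cls_add, cls_sub] at this
    exact (sub_pos.2 this).trans_eq (by abel)
  · have := cls_lt.2 (hxy.lt_right (opt_mul.2 ⟨true, x', y', hx', hy', rfl⟩))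
    simp only [cls_add, cls_sub] at this
    exact (sub_pos.2 this).trans_eq (by abel)
  · have := cls_lt.2 (hxy.lt_right (opt_mul.2 ⟨false, x', y', hx', hy', rfl⟩))
    simp only [cls_add, cls_sub] at this
    exact (sub_pos.2 this).trans_eq (by abel)
  · have := cls_lt.2 (hxy.left_lt (opt_mul.2 ⟨false, x', y', hx', hy', rfl⟩))
    simp only [cls_add, cls_sub] at this
    exact (sub_pos.2 this).trans_eq (by abel)

/-- A left option built from `(x₁, y₁)` is compared with a right option built from `(x₂, y₂)` by
changing one coordinate at a time, through the expression built from `(x₁, y₂)` or `(x₂, y₁)`. Each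
change contributes a cross difference. Exactly one coordinate has both entries on the same side, and
their order decides which intermediate expression makes both contributions positive. -/
theorem isSurreal_mul_of_opt {x y : Game.{u}} (hx : x.IsSurreal) (hy : y.IsSurreal)
    (hl : ∀ s x', Opt s x' x → (x' * y).IsSurreal) (hr : ∀ s y', Opt s y' y → (x * y').IsSurreal)
    (hlr : ∀ s t x' y', Opt s x' x → Opt t y' y → (x' * y').IsSurreal)
    (mx : ∀ s t x₁ x₂, Opt s x₁ x → Opt t x₂ x → MulMono x₁ x₂ y ∧
      ∀ r y', Opt r y' y → MulMono x₁ x₂ y')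
    (my : ∀ s t y₁ y₂, Opt s y₁ y → Opt t y₂ y → MulMono y₁ y₂ x ∧
      ∀ r x', Opt r x' x → MulMono y₁ y₂ x') : (x * y).IsSurreal := by
  have cX : ∀ s t r x₁ x₂ w, Opt s x₁ x → Opt t x₂ x → Opt r w y → x₁ ≤ x₂ → x₂ ≤ x₁ →
      cls (x₁ * y) = cls (x₂ * y) ∧ cls (x₁ * w) = cls (x₂ * w) := fun s t r x₁ x₂ w h h' hw e e' =>
    ⟨(mx s t x₁ x₂ h h').1.1 ⟨e, e'⟩, ((mx s t x₁ x₂ h h').2 r w hw).1 ⟨e, e'⟩⟩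
  have cY : ∀ s t r y₁ y₂ w, Opt s y₁ y → Opt t y₂ y → Opt r w x → y₁ ≤ y₂ → y₂ ≤ y₁ →
      cls (x * y₁) = cls (x * y₂) ∧ cls (w * y₁) = cls (w * y₂) := by
    intro s t r y₁ y₂ w h h' hw e e'
    rw [game_mul_comm x, game_mul_comm x, game_mul_comm w, game_mul_comm w]
    exact ⟨(my s t y₁ y₂ h h').1.1 ⟨e, e'⟩, ((my s t y₁ y₂ h h').2 r w hw).1 ⟨e, e'⟩⟩
  have hX : ∀ s t x₁ x₂, Opt s x₁ x → Opt t x₂ x → x₁ < x₂ → ∀ r y', Opt r y' y →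
      (y' < y → 0 < crossDiff x₁ x₂ y' y) ∧ (y < y' → 0 < crossDiff x₁ x₂ y y') :=
    fun s t x₁ x₂ h h' => (mx s t x₁ x₂ h h').1.2
  have hY : ∀ s t y₁ y₂, Opt s y₁ y → Opt t y₂ y → y₁ < y₂ → ∀ r x', Opt r x' x →
      (x' < x → 0 < crossDiff x' x y₁ y₂) ∧ (x < x' → 0 < crossDiff x x' y₁ y₂) := by
    intro s t y₁ y₂ h h' hlt r x' hx'
    rw [crossDiff_comm x', crossDiff_comm x]
    exact (my s t y₁ y₂ h h').1.2 hlt r x' hx'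
  have tri : ∀ a b : Game.{u}, a.IsSurreal → b.IsSurreal → (a ≤ b ∧ b ≤ a) ∨ a < b ∨ b < a := by
    intro a b ha hb
    by_cases h : a ≤ b
    · by_cases h' : b ≤ a
      · exact .inl ⟨h, h'⟩
      · exact .inr (.inl ⟨h, h'⟩)
    · exact .inr (.inr ((ha.not_le hb).1 h))
  refine isSurreal_iff.2 ⟨fun l r h h' hle => ?_, fun s z hz => ?_⟩
  · refine (lt_irrefl (cls l)) (lt_of_lt_of_le ?_ (cls_le.2 hle))
    obtain ⟨t₁, x₁, y₁, hx₁, hy₁, rfl⟩ := opt_mul.1 h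
    obtain ⟨t₂, x₂, y₂, hx₂, hy₂, rfl⟩ := opt_mul.1 h'
    simp only [cls_add, cls_sub]
    rw [← sub_pos]
    have sx₁ := hx.opt hx₁
    have sx₂ := hx.opt hx₂
    have sy₁ := hy.opt hy₁
    have sy₂ := hy.opt hy₂
    cases t₁ <;> cases t₂
    · -- `x < x₁`, `y < y₁`, `x < x₂`, `y₂ < y`
      have a₁ := hx.lt_right hx₁
      have b₁ := hy.lt_right hy₁
      have a₂ := hx.lt_right hx₂
      have b₂ := hy.left_lt hy₂
      have p₁ := (hY _ _ _ _ hy₂ hy₁ (b₂.trans b₁) _ _ hx₁).2 a₁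
      have p₂ := (hY _ _ _ _ hy₂ hy₁ (b₂.trans b₁) _ _ hx₂).2 a₂
      rcases tri x₁ x₂ sx₁ sx₂ with ⟨e, e'⟩ | e | e
      · obtain ⟨q, q'⟩ := cX _ _ _ _ _ _ hx₁ hx₂ hy₁ e e'
        rw [q, q']
        exact p₂.trans_eq (by simp only [crossDiff]; abel)
      · have q := (hX _ _ _ _ hx₁ hx₂ e _ _ hy₂).1 b₂
        exact (add_pos p₁ q).trans_eq (by simp only [crossDiff]; abel)
      · have q := (hX _ _ _ _ hx₂ hx₁ e _ _ hy₁).2 b₁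
        exact (add_pos p₂ q).trans_eq (by simp only [crossDiff]; abel)
    · -- `x < x₁`, `y < y₁`, `x₂ < x`, `y < y₂`
      have a₁ := hx.lt_right hx₁
      have b₁ := hy.lt_right hy₁
      have a₂ := hx.left_lt hx₂
      have b₂ := hy.lt_right hy₂
      have p₁ := (hX _ _ _ _ hx₂ hx₁ (a₂.trans a₁) _ _ hy₁).2 b₁
      have p₂ := (hX _ _ _ _ hx₂ hx₁ (a₂.trans a₁) _ _ hy₂).2 b₂
      rcases tri y₁ y₂ sy₁ sy₂ with ⟨e, e'⟩ | e | e
      · obtain ⟨q, q'⟩ := cY _ _ _ _ _ _ hy₁ hy₂ hx₁ e e'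
        rw [q, q']
        exact p₂.trans_eq (by simp only [crossDiff]; abel)
      · have q := (hY _ _ _ _ hy₁ hy₂ e _ _ hx₂).1 a₂
        exact (add_pos p₁ q).trans_eq (by simp only [crossDiff]; abel)
      · have q := (hY _ _ _ _ hy₂ hy₁ e _ _ hx₁).2 a₁
        exact (add_pos p₂ q).trans_eq (by simp only [crossDiff]; abel)
    · -- `x₁ < x`, `y₁ < y`, `x < x₂`, `y₂ < y`
      have a₁ := hx.left_lt hx₁
      have b₁ := hy.left_lt hy₁
      have a₂ := hx.lt_right hx₂
      have b₂ := hy.left_lt hy₂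
      have p₁ := (hX _ _ _ _ hx₁ hx₂ (a₁.trans a₂) _ _ hy₁).1 b₁
      have p₂ := (hX _ _ _ _ hx₁ hx₂ (a₁.trans a₂) _ _ hy₂).1 b₂
      rcases tri y₁ y₂ sy₁ sy₂ with ⟨e, e'⟩ | e | e
      · obtain ⟨q, q'⟩ := cY _ _ _ _ _ _ hy₁ hy₂ hx₁ e e'
        rw [q, q']
        exact p₂.trans_eq (by simp only [crossDiff]; abel)
      · have q := (hY _ _ _ _ hy₁ hy₂ e _ _ hx₁).1 a₁
        exact (add_pos p₂ q).trans_eq (by simp only [crossDiff]; abel)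
      · have q := (hY _ _ _ _ hy₂ hy₁ e _ _ hx₂).2 a₂
        exact (add_pos p₁ q).trans_eq (by simp only [crossDiff]; abel)
    · -- `x₁ < x`, `y₁ < y`, `x₂ < x`, `y < y₂`
      have a₁ := hx.left_lt hx₁
      have b₁ := hy.left_lt hy₁
      have a₂ := hx.left_lt hx₂
      have b₂ := hy.lt_right hy₂
      have p₁ := (hY _ _ _ _ hy₁ hy₂ (b₁.trans b₂) _ _ hx₁).1 a₁
      have p₂ := (hY _ _ _ _ hy₁ hy₂ (b₁.trans b₂) _ _ hx₂).1 a₂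
      rcases tri x₁ x₂ sx₁ sx₂ with ⟨e, e'⟩ | e | e
      · obtain ⟨q, q'⟩ := cX _ _ _ _ _ _ hx₁ hx₂ hy₁ e e'
        rw [q, q']
        exact p₂.trans_eq (by simp only [crossDiff]; abel)
      · have q := (hX _ _ _ _ hx₁ hx₂ e _ _ hy₁).1 b₁
        exact (add_pos p₂ q).trans_eq (by simp only [crossDiff]; abel)
      · have q := (hX _ _ _ _ hx₂ hx₁ e _ _ hy₂).2 b₂
        exact (add_pos p₁ q).trans_eq (by simp only [crossDiff]; abel)
  · obtain ⟨t, x', y', hx', hy', rfl⟩ := opt_mul.1 hz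
    exact ((hl _ _ hx').add (hr _ _ hy')).sub (hlr _ _ _ _ hx' hy')

/-- Since `x₁ y'` and `x₂ y'` have the same value by `m`, the gap between an option of one product
and the other product is a single cross difference, to which strict monotonicity applies. -/
theorem mul_le_mul_of_opt {x₁ x₂ y : Game.{u}} (hx₁ : x₁.IsSurreal) (hx₂ : x₂.IsSurreal)
    (hy : y.IsSurreal)
    (m₁ : ∀ s x', Opt s x' x₁ → MulMono x' x₂ y ∧ MulMono x₂ x' y)
    (m₂ : ∀ s x', Opt s x' x₂ → MulMono x' x₁ y ∧ MulMono x₁ x' y)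
    (m : ∀ s y', Opt s y' y → MulMono x₁ x₂ y') (h : x₁ ≈ x₂) : x₁ * y ≤ x₂ * y := by
  refine le_iff_opt.2 ⟨fun z hz hle => ?_, fun z hz hle => ?_⟩
  · refine (lt_irrefl (cls z)) (lt_of_lt_of_le ?_ (cls_le.2 hle))
    obtain ⟨t, x', y', hx', hy', rfl⟩ := opt_mul.1 hz
    have e := (m _ _ hy').1 h
    simp only [cls_add, cls_sub]
    rw [← sub_pos, e]
    cases t
    · exact (((m₁ _ _ hx').2.2 (h.2.trans_lt (hx₁.lt_right hx')) _ _ hy').2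
        (hy.lt_right hy')).trans_eq (by simp only [crossDiff]; abel)
    · exact (((m₁ _ _ hx').1.2 ((hx₁.left_lt hx').trans_le h.1) _ _ hy').1
        (hy.left_lt hy')).trans_eq (by simp only [crossDiff]; abel)
  · refine (lt_irrefl (cls z)) (lt_of_le_of_lt (cls_le.2 hle) ?_)
    obtain ⟨t, x', y', hx', hy', rfl⟩ := opt_mul.1 hz
    have e := (m _ _ hy').1 h
    simp only [cls_add, cls_sub]
    rw [← sub_pos, ← e]
    cases t
    · exact (((m₂ _ _ hx').2.2 (h.1.trans_lt (hx₂.lt_right hx')) _ _ hy').1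
        (hy.left_lt hy')).trans_eq (by simp only [crossDiff]; abel)
    · exact (((m₂ _ _ hx').1.2 ((hx₂.left_lt hx').trans_le h.2) _ _ hy').2
        (hy.lt_right hy')).trans_eq (by simp only [crossDiff])

theorem crossDiff_eq_zero {x₁ x₂ y₁ y₂ : Game.{u}} (h₁ : cls (x₁ * y₁) = cls (x₂ * y₁))
    (h₂ : cls (x₁ * y₂) = cls (x₂ * y₂)) : crossDiff x₁ x₂ y₁ y₂ = 0 := by
  rw [crossDiff, h₁, h₂]
  abel

theorem MulMono.crossDiff_nonneg {x₁ x₂ y y' : Game.{u}} {s : Bool} (hy' : Opt s y' y)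
    (m : MulMono x₁ x₂ y) (m' : MulMono x₁ x₂ y') (h : x₁ ≤ x₂) :
    (y' < y → 0 ≤ crossDiff x₁ x₂ y' y) ∧ (y < y' → 0 ≤ crossDiff x₁ x₂ y y') := by
  by_cases h' : x₂ ≤ x₁
  · rw [crossDiff_eq_zero (m.1 ⟨h, h'⟩) (m'.1 ⟨h, h'⟩),
      crossDiff_eq_zero (m'.1 ⟨h, h'⟩) (m.1 ⟨h, h'⟩)]
    exact ⟨fun _ => le_rfl, fun _ => le_rfl⟩
  · exact ⟨fun k => ((m.2 ⟨h, h'⟩ _ _ hy').1 k).le, fun k => ((m.2 ⟨h, h'⟩ _ _ hy').2 k).le⟩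

/-- If `x₁ < x₂`, some option `z` satisfies `x₁ < z ≤ x₂` or `x₁ ≤ z < x₂`. The cross difference
splits at `z` into a part positive because `z` is an option, and a part nonnegative by the assumed
monotonicity at `z`. -/
theorem mulMono_of_opt {x₁ x₂ y : Game.{u}} (hx₁ : x₁.IsSurreal) (hx₂ : x₂.IsSurreal)
    (hy : y.IsSurreal) (h₁ : (x₁ * y).IsSurreal) (h₂ : (x₂ * y).IsSurreal)
    (m₁ : ∀ s x', Opt s x' x₁ → (MulMono x' x₂ y ∧ MulMono x₂ x' y) ∧
      ∀ t y', Opt t y' y → MulMono x' x₂ y')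
    (m₂ : ∀ s x', Opt s x' x₂ → (MulMono x' x₁ y ∧ MulMono x₁ x' y) ∧
      ∀ t y', Opt t y' y → MulMono x₁ x' y')
    (m : ∀ s y', Opt s y' y → MulMono x₁ x₂ y' ∧ MulMono x₂ x₁ y') : MulMono x₁ x₂ y := by
  refine ⟨fun h => cls_eq.2 ⟨?_, ?_⟩, fun h s y' hy' => ?_⟩
  · exact mul_le_mul_of_opt hx₁ hx₂ hy (fun s x' h => (m₁ s x' h).1) (fun s x' h => (m₂ s x' h).1)
      (fun s y' h => (m s y' h).1) h
  · exact mul_le_mul_of_opt hx₂ hx₁ hy (fun s x' h => (m₂ s x' h).1) (fun s x' h => (m₁ s x' h).1)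
      (fun s y' h => (m s y' h).2) ⟨h.2, h.1⟩
  · rcases exists_opt_of_not_le h.2 with ⟨z, hz, hle⟩ | ⟨z, hz, hle⟩
    · obtain ⟨-, -, p, q⟩ := hx₁.crossDiff_pos hy h₁ hz hy'
      have hlt := hx₁.lt_right hz
      have n := MulMono.crossDiff_nonneg hy' (m₁ _ _ hz).1.1 ((m₁ _ _ hz).2 _ _ hy') hle
      rw [← crossDiff_add x₁ z x₂ y' y, ← crossDiff_add x₁ z x₂ y y']
      exact ⟨fun k => add_pos_of_pos_of_nonneg (p hlt k) (n.1 k),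
        fun k => add_pos_of_pos_of_nonneg (q hlt k) (n.2 k)⟩
    · obtain ⟨p, q, -, -⟩ := hx₂.crossDiff_pos hy h₂ hz hy'
      have hlt := hx₂.left_lt hz
      have n := MulMono.crossDiff_nonneg hy' (m₂ _ _ hz).1.2 ((m₂ _ _ hz).2 _ _ hy') hle
      rw [← crossDiff_add x₁ z x₂ y' y, ← crossDiff_add x₁ z x₂ y y']
      exact ⟨fun k => add_pos_of_nonneg_of_pos (n.1 k) (p hlt k),
        fun k => add_pos_of_nonneg_of_pos (n.2 k) (q hlt k)⟩

/-! The induction is along the hydra order on multisets of games. -/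

/-- `M` arises from `N` by repeatedly replacing a game by finitely many of its options. -/
def MultisetLT : Multiset Game.{u} → Multiset Game.{u} → Prop :=
  Relation.TransGen (Relation.CutExpand IsOption)

theorem wf_multisetLT : WellFounded MultisetLT.{u} :=
  wf_isOption.cutExpand.transGen

theorem multisetLT_of_eq {M N : Multiset Game.{u}} (t w : Multiset Game.{u}) (x : Game.{u})
    (h : ∀ a ∈ t, IsOption a x) (hM : M = t + w) (hN : N = {x} + w) : MultisetLT M N := by
  subst hM hN
  exact .single ⟨t, x, h, by abel⟩

theorem multisetLT_one {x a : Game.{u}} (w : Multiset Game.{u}) (h : IsOption a x) :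
    MultisetLT ({a} + w) ({x} + w) :=
  multisetLT_of_eq {a} w x (by simpa using h) rfl rfl

theorem multisetLT_two {x a b : Game.{u}} (w : Multiset Game.{u}) (h : IsOption a x)
    (h' : IsOption b x) : MultisetLT ({a} + {b} + w) ({x} + w) :=
  multisetLT_of_eq ({a} + {b}) w x (by simp [h, h']) rfl rfl

theorem multisetLT_zero (x : Game.{u}) (w : Multiset Game.{u}) : MultisetLT w ({x} + w) :=
  multisetLT_of_eq 0 w x (by simp) (by simp) rfl

theorem MultisetLT.trans {M N P : Multiset Game.{u}} (h : MultisetLT M N) (h' : MultisetLT N P) :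
    MultisetLT M P :=
  Relation.TransGen.trans h h'

/-- The two claims feed each other. For `x * y` one needs monotonicity at triples such as `{x₁, x₂,
y}` with `x₁`, `x₂` options of `x`: one game is replaced by two smaller ones. For a triple `{x₁, x₂,
y}` one needs the products `xᵢ * y`: one game is deleted. Both moves descend in the hydra order. -/
theorem isSurreal_mul_and_mulMono (M : Multiset Game.{u}) :
    (∀ x y : Game.{u}, x.IsSurreal → y.IsSurreal → M = {x} + {y} → (x * y).IsSurreal) ∧
    (∀ x₁ x₂ y : Game.{u}, x₁.IsSurreal → x₂.IsSurreal → y.IsSurreal → M = {x₁} + {x₂} + {y} →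
      MulMono x₁ x₂ y) := by
  induction M using wf_multisetLT.induction with
  | _ M ih =>
    have ih₁ : ∀ x y : Game.{u}, x.IsSurreal → y.IsSurreal → MultisetLT ({x} + {y}) M →
        (x * y).IsSurreal := fun x y hx hy h => (ih _ h).1 x y hx hy rfl
    have ih₂ : ∀ x₁ x₂ y : Game.{u}, x₁.IsSurreal → x₂.IsSurreal → y.IsSurreal →
        MultisetLT ({x₁} + {x₂} + {y}) M → MulMono x₁ x₂ y :=
      fun x₁ x₂ y h₁ h₂ hy h => (ih _ h).2 x₁ x₂ y h₁ h₂ hy rfl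
    have sw : ∀ a b : Game.{u}, ({a} + {b} : Multiset Game.{u}) = {b} + {a} := fun a b =>
      add_comm _ _
    constructor
    · rintro x y hx hy rfl
      refine isSurreal_mul_of_opt hx hy (fun s x' h => ?_) (fun s y' h => ?_)
        (fun s t x' y' h h' => ?_) (fun s t x₁ x₂ h h' => ⟨?_, fun r y' hy' => ?_⟩)
        (fun s t y₁ y₂ h h' => ⟨?_, fun r x' hx' => ?_⟩)
      · exact ih₁ _ _ (hx.opt h) hy (multisetLT_one _ h.isOption)
      · exact ih₁ _ _ hx (hy.opt h) (by rw [sw x, sw x]; exact multisetLT_one _ h.isOption)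
      · refine ih₁ _ _ (hx.opt h) (hy.opt h') ((multisetLT_one _ h.isOption).trans ?_)
        rw [sw x, sw x]
        exact multisetLT_one _ h'.isOption
      · exact ih₂ _ _ _ (hx.opt h) (hx.opt h') hy (multisetLT_two _ h.isOption h'.isOption)
      · refine ih₂ _ _ _ (hx.opt h) (hx.opt h') (hy.opt hy')
          ((multisetLT_two _ h.isOption h'.isOption).trans ?_)
        rw [sw x, sw x]
        exact multisetLT_one _ hy'.isOption
      · rw [sw x] at ih₂
        exact ih₂ _ _ _ (hy.opt h) (hy.opt h') hx (multisetLT_two _ h.isOption h'.isOption)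
      · refine ih₂ _ _ _ (hy.opt h) (hy.opt h') (hx.opt hx')
          ((multisetLT_two _ h.isOption h'.isOption).trans ?_)
        rw [sw y]
        exact multisetLT_one _ hx'.isOption
    · rintro x₁ x₂ y hx₁ hx₂ hy rfl
      have r₁ : ∀ x', IsOption x' x₁ → ∀ w,
          MultisetLT ({x'} + {x₂} + {w}) ({x₁} + {x₂} + {w}) ∧
          MultisetLT ({x₂} + {x'} + {w}) ({x₁} + {x₂} + {w}) := by
        intro x' h w
        rw [sw x₂ x', add_assoc, add_assoc]
        exact ⟨multisetLT_one _ h, multisetLT_one _ h⟩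
      have r₂ : ∀ x', IsOption x' x₂ → ∀ w,
          MultisetLT ({x'} + {x₁} + {w}) ({x₁} + {x₂} + {w}) ∧
          MultisetLT ({x₁} + {x'} + {w}) ({x₁} + {x₂} + {w}) := by
        intro x' h w
        rw [sw x₁ x', sw x₁ x₂, add_assoc, add_assoc]
        exact ⟨multisetLT_one _ h, multisetLT_one _ h⟩
      have r₃ : ∀ y', IsOption y' y →
          MultisetLT ({x₁} + {x₂} + {y'}) ({x₁} + {x₂} + {y}) := by
        intro y' h
        rw [add_comm _ ({y'} : Multiset Game.{u}), add_comm _ ({y} : Multiset Game.{u})]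
        exact multisetLT_one _ h
      refine mulMono_of_opt hx₁ hx₂ hy (ih₁ _ _ hx₁ hy ?_) (ih₁ _ _ hx₂ hy ?_)
        (fun s x' h => ⟨⟨?_, ?_⟩, fun t y' h' => ?_⟩) (fun s x' h => ⟨⟨?_, ?_⟩, fun t y' h' => ?_⟩)
        (fun s y' h => ⟨?_, ?_⟩)
      · rw [sw x₁ x₂, add_assoc]
        exact multisetLT_zero _ _
      · rw [add_assoc]
        exact multisetLT_zero _ _
      · exact ih₂ _ _ _ (hx₁.opt h) hx₂ hy (r₁ _ h.isOption _).1
      · exact ih₂ _ _ _ hx₂ (hx₁.opt h) hy (r₁ _ h.isOption _).2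
      · exact ih₂ _ _ _ (hx₁.opt h) hx₂ (hy.opt h') ((r₁ _ h.isOption _).1.trans (r₃ _ h'.isOption))
      · exact ih₂ _ _ _ (hx₂.opt h) hx₁ hy (r₂ _ h.isOption _).1
      · exact ih₂ _ _ _ hx₁ (hx₂.opt h) hy (r₂ _ h.isOption _).2
      · exact ih₂ _ _ _ hx₁ (hx₂.opt h) (hy.opt h') ((r₂ _ h.isOption _).2.trans (r₃ _ h'.isOption))
      · exact ih₂ _ _ _ hx₁ hx₂ (hy.opt h) (r₃ _ h.isOption)
      · refine ih₂ _ _ _ hx₂ hx₁ (hy.opt h) ?_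
        rw [sw x₂ x₁]
        exact r₃ _ h.isOption

theorem IsSurreal.mul {x y : Game.{u}} (hx : x.IsSurreal) (hy : y.IsSurreal) :
    (x * y).IsSurreal :=
  (isSurreal_mul_and_mulMono _).1 x y hx hy rfl

theorem IsSurreal.mulMono {x₁ x₂ y : Game.{u}} (h₁ : x₁.IsSurreal) (h₂ : x₂.IsSurreal)
    (hy : y.IsSurreal) : MulMono x₁ x₂ y :=
  (isSurreal_mul_and_mulMono _).2 x₁ x₂ y h₁ h₂ hy rfl

/-- As `0` has no options, `0 < y` yields a left option `z ≥ 0` of `y`. Then `x z < x y` by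
monotonicity from `0 < x`, and `0 ≤ x z` by induction. -/
theorem IsSurreal.mul_pos {x y : Game.{u}} (hx : x.IsSurreal) (hy : y.IsSurreal) (h : 0 < x)
    (h' : 0 < y) : 0 < x * y := by
  induction y using optInduction with
  | h y ih =>
    rcases exists_opt_of_not_le h'.2 with ⟨z, hz, _⟩ | ⟨z, hz, hle⟩
    · exact (opt_zero hz).elim
    have p := ((isSurreal_zero.mulMono hx hy).2 h _ _ hz).1 (hy.left_lt hz)
    simp only [crossDiff, game_zero_mul, zero_add, sub_zero] at p
    have n : 0 ≤ cls (x * z) := by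
      by_cases hz' : z ≤ 0
      · rw [game_mul_comm, ((hy.opt hz).mulMono isSurreal_zero hx).1 ⟨hz', hle⟩, game_zero_mul]
      · exact (cls_lt.2 (ih _ z hz (hy.opt hz) ⟨hle, hz'⟩)).le
    exact cls_lt.1 (n.trans_lt (sub_pos.1 p))

/-! ### The ordered field of surreal numbers up to equivalence -/

/-- The values of surreal numbers. -/
def numberSubgroup : AddSubgroup Value.{u} where
  carrier := {v | ∃ x : Game.{u}, x.IsSurreal ∧ cls x = v}
  add_mem' := by rintro _ _ ⟨x, hx, rfl⟩ ⟨y, hy, rfl⟩; exact ⟨_, hx.add hy, rfl⟩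
  zero_mem' := ⟨0, isSurreal_zero, rfl⟩
  neg_mem' := by rintro _ ⟨x, hx, rfl⟩; exact ⟨_, hx.neg, rfl⟩

/-- Surreal numbers up to `≈`. -/
def Number : Type (u + 1) := numberSubgroup.{u}

instance : AddCommGroup Number.{u} := inferInstanceAs (AddCommGroup numberSubgroup.{u})
instance : PartialOrder Number.{u} := inferInstanceAs (PartialOrder numberSubgroup.{u})
instance : IsOrderedAddMonoid Number.{u} := inferInstanceAs (IsOrderedAddMonoid numberSubgroup.{u})

/-- `Rep x a`: `x` is a surreal number of value `a`. -/
def Rep (x : Game.{u}) (a : Number.{u}) : Prop := x.IsSurreal ∧ cls x = a.1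

theorem IsSurreal.exists_rep {x : Game.{u}} (hx : x.IsSurreal) : ∃ a, Rep x a :=
  ⟨⟨cls x, x, hx, rfl⟩, hx, rfl⟩

theorem Number.exists_rep (a : Number.{u}) : ∃ x, Rep x a := a.2

namespace Rep

variable {x y : Game.{u}} {a b : Number.{u}}

theorem unique (h : Rep x a) (h' : Rep x b) : a = b := Subtype.ext (h.2.symm.trans h'.2)

theorem le_iff_le (h : Rep x a) (h' : Rep y b) : x ≤ y ↔ a ≤ b := by
  rw [← cls_le, h.2, h'.2]; rfl

theorem lt_iff_lt (h : Rep x a) (h' : Rep y b) : x < y ↔ a < b := by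
  rw [← cls_lt, h.2, h'.2]; rfl

theorem equiv_iff_eq (h : Rep x a) (h' : Rep y b) : x ≈ y ↔ a = b := by
  rw [← cls_eq, h.2, h'.2]; exact Subtype.ext_iff.symm

theorem zero : Rep (0 : Game.{u}) 0 := ⟨isSurreal_zero, rfl⟩

theorem add (h : Rep x a) (h' : Rep y b) : Rep (x + y) (a + b) :=
  ⟨h.1.add h'.1, by rw [cls_add, h.2, h'.2]; rfl⟩

theorem neg (h : Rep x a) : Rep (-x) (-a) := ⟨h.1.neg, by rw [cls_neg, h.2]; rfl⟩

theorem sub (h : Rep x a) (h' : Rep y b) : Rep (x - y) (a - b) := by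
  rw [sub_eq_add_neg]; exact h.add h'.neg

end Rep

instance : One Number.{u} := ⟨⟨cls 1, 1, isSurreal_one, rfl⟩⟩

instance : Mul Number.{u} :=
  ⟨fun a b => ⟨cls (a.exists_rep.choose * b.exists_rep.choose), _,
    a.exists_rep.choose_spec.1.mul b.exists_rep.choose_spec.1, rfl⟩⟩

theorem Rep.one : Rep (1 : Game.{u}) 1 := ⟨isSurreal_one, rfl⟩

/-- The product on `Number` uses chosen representatives. The first half of `MulMono` makes the
choice immaterial. -/
theorem Rep.mul {x y : Game.{u}} {a b : Number.{u}} (h : Rep x a) (h' : Rep y b) :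
    Rep (x * y) (a * b) := by
  refine ⟨h.1.mul h'.1, ?_⟩
  have e := a.exists_rep.choose_spec
  have e' := b.exists_rep.choose_spec
  change cls (x * y) = cls (a.exists_rep.choose * b.exists_rep.choose)
  rw [(h.1.mulMono e.1 h'.1).1 ((h.equiv_iff_eq e).2 rfl), game_mul_comm,
    game_mul_comm _ (b.exists_rep.choose), (h'.1.mulMono e'.1 e.1).1 ((h'.equiv_iff_eq e').2 rfl)]

theorem Rep.eq_of_cls {x y : Game.{u}} {a b : Number.{u}} (h : Rep x a) (h' : Rep y b)
    (e : cls x = cls y) : a = b :=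
  Subtype.ext (h.2.symm.trans (e.trans h'.2))

theorem Number.mul_comm' (a b : Number.{u}) : a * b = b * a := by
  obtain ⟨x, hx⟩ := a.exists_rep
  obtain ⟨y, hy⟩ := b.exists_rep
  exact (hx.mul hy).eq_of_cls (hy.mul hx) (game_mul_comm x y)

theorem Number.mul_add' (a b c : Number.{u}) : a * (b + c) = a * b + a * c := by
  obtain ⟨x, hx⟩ := a.exists_rep
  obtain ⟨y, hy⟩ := b.exists_rep
  obtain ⟨z, hz⟩ := c.exists_rep
  exact (hx.mul (hy.add hz)).eq_of_cls ((hx.mul hy).add (hx.mul hz)) (game_mul_add x y z)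

theorem Number.one_mul' (a : Number.{u}) : 1 * a = a := by
  obtain ⟨x, hx⟩ := a.exists_rep
  exact (Rep.one.mul hx).eq_of_cls hx (game_one_mul x)

theorem Number.zero_mul' (a : Number.{u}) : 0 * a = 0 := by
  obtain ⟨x, hx⟩ := a.exists_rep
  exact (Rep.zero.mul hx).eq_of_cls Rep.zero (game_zero_mul x)

theorem Number.mul_assoc' (a b c : Number.{u}) : a * b * c = a * (b * c) := by
  obtain ⟨x, hx⟩ := a.exists_rep
  obtain ⟨y, hy⟩ := b.exists_rep
  obtain ⟨z, hz⟩ := c.exists_rep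
  exact ((hx.mul hy).mul hz).eq_of_cls (hx.mul (hy.mul hz)) (game_mul_assoc x y z)

instance : CommRing Number.{u} where
  __ := (inferInstance : AddCommGroup Number.{u})
  left_distrib := Number.mul_add'
  right_distrib a b c := by
    rw [Number.mul_comm', Number.mul_add', Number.mul_comm' c, Number.mul_comm' c]
  zero_mul := Number.zero_mul'
  mul_zero a := by rw [Number.mul_comm', Number.zero_mul']
  mul_assoc := Number.mul_assoc'
  mul_comm := Number.mul_comm'
  one_mul := Number.one_mul'
  mul_one a := by rw [Number.mul_comm', Number.one_mul']

open Classical in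
instance : LinearOrder Number.{u} where
  __ := (inferInstance : PartialOrder Number.{u})
  le_total a b := by
    obtain ⟨x, hx⟩ := a.exists_rep
    obtain ⟨y, hy⟩ := b.exists_rep
    rw [← hx.le_iff_le hy, ← hy.le_iff_le hx]
    exact hx.1.le_total hy.1
  toDecidableLE := inferInstance

theorem Number.zero_lt_one' : (0 : Number.{u}) < 1 :=
  (Rep.zero.lt_iff_lt Rep.one).1 (isSurreal_one.left_lt (opt_one.2 ⟨rfl, rfl⟩))

instance : Nontrivial Number.{u} := ⟨0, 1, Number.zero_lt_one'.ne⟩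

instance : ZeroLEOneClass Number.{u} := ⟨Number.zero_lt_one'.le⟩

instance : IsStrictOrderedRing Number.{u} := .of_mul_pos fun a b ha hb => by
  obtain ⟨x, hx⟩ := a.exists_rep
  obtain ⟨y, hy⟩ := b.exists_rep
  rw [← Rep.zero.lt_iff_lt hx] at ha
  rw [← Rep.zero.lt_iff_lt hy] at hb
  exact (Rep.zero.lt_iff_lt (hx.mul hy)).1 (hx.1.mul_pos hy.1 ha hb)

theorem Rep.left_lt {x z : Game.{u}} {a c : Number.{u}} (h : Rep x a) (hz : Opt true z x)
    (hc : Rep z c) : c < a :=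
  (hc.lt_iff_lt h).1 (h.1.left_lt hz)

theorem Rep.lt_right {x z : Game.{u}} {a c : Number.{u}} (h : Rep x a) (hz : Opt false z x)
    (hc : Rep z c) : a < c :=
  (h.lt_iff_lt hc).1 (h.1.lt_right hz)

theorem Rep.le_of_opt {x y : Game.{u}} {a b : Number.{u}} (h : Rep x a) (h' : Rep y b)
    (hl : ∀ z, Opt true z x → ∃ c, Rep z c ∧ c < b)
    (hr : ∀ z, Opt false z y → ∃ c, Rep z c ∧ a < c) : a ≤ b := by
  refine (h.le_iff_le h').1 (le_iff_opt.2 ⟨fun z hz hle => ?_, fun z hz hle => ?_⟩)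
  · obtain ⟨c, hc, hlt⟩ := hl z hz
    exact ((hc.lt_iff_lt h').2 hlt).2 hle
  · obtain ⟨c, hc, hlt⟩ := hr z hz
    exact ((h.lt_iff_lt hc).2 hlt).2 hle

theorem isSurreal_of_rep {x : Game.{u}}
    (h : ∀ l r, Opt true l x → Opt false r x → ∃ a b, Rep l a ∧ Rep r b ∧ a < b)
    (h' : ∀ s z, Opt s z x → z.IsSurreal) : x.IsSurreal := by
  refine isSurreal_iff.2 ⟨fun l r hl hr => ?_, h'⟩
  obtain ⟨a, b, ha, hb, hlt⟩ := h l r hl hr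
  exact ((ha.lt_iff_lt hb).2 hlt).2

/-! ### Families -/

namespace Fam

/-- Membership in a family. -/
def Mem (z : Game.{u}) (A : Fam.{u}) : Prop := ∃ i, A.val i = z

theorem mem_union {z : Game.{u}} {A B : Fam.{u}} : Mem z (A.union B) ↔ Mem z A ∨ Mem z B :=
  ⟨by rintro ⟨i | i, rfl⟩; exacts [.inl ⟨i, rfl⟩, .inr ⟨i, rfl⟩],
    by rintro (⟨i, rfl⟩ | ⟨i, rfl⟩); exacts [⟨.inl i, rfl⟩, ⟨.inr i, rfl⟩]⟩

theorem mem_iUnion {z : Game.{u}} {A : ℕ → Fam.{u}} : Mem z (iUnion A) ↔ ∃ n, Mem z (A n) :=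
  ⟨by rintro ⟨⟨n, i⟩, rfl⟩; exact ⟨n, i, rfl⟩, by rintro ⟨n, i, rfl⟩; exact ⟨⟨n, i⟩, rfl⟩⟩

theorem mem_invStep {z p : Game.{u}} {κ : Type u} {q qinv : κ → Game.{u}} {Y : Fam.{u}} :
    Mem z (invStep p q qinv Y) ↔ ∃ k y, Mem y Y ∧ z = (1 + (q k - p) * y) * qinv k :=
  ⟨by rintro ⟨⟨k, i⟩, rfl⟩; exact ⟨k, _, ⟨i, rfl⟩, rfl⟩,
    by rintro ⟨k, _, ⟨i, rfl⟩, rfl⟩; exact ⟨⟨k, i⟩, rfl⟩⟩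

theorem mem_sqrtStep {z x : Game.{u}} {A B : Fam.{u}} : Mem z (sqrtStep x A B) ↔
    ∃ a b, Mem a A ∧ Mem b B ∧ ¬ 0 ≈ a + b ∧ z = (x + a * b) / (a + b) :=
  ⟨by rintro ⟨⟨⟨i, j⟩, h⟩, rfl⟩; exact ⟨_, _, ⟨i, rfl⟩, ⟨j, rfl⟩, h, rfl⟩,
    by rintro ⟨_, _, ⟨i, rfl⟩, ⟨j, rfl⟩, h, rfl⟩; exact ⟨⟨⟨i, j⟩, h⟩, rfl⟩⟩

end Fam

open Fam

/-! ### Inverses -/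

/-- For `c' = (1 + (q - a) c)/q` one has `q (1 - a c') = (q - a)(1 - a c)`. With `q > 0`, the side
of `1` on which `a c'` falls is determined by the signs of `q - a` and `1 - a c`. -/
theorem invSeq_spec {p : Game.{u}} {a : Number.{u}} (hp : Rep p a) (ha : 0 < a) {κ μ : Type u}
    {l linv : κ → Game.{u}} {r rinv : μ → Game.{u}}
    (hl : ∀ k, ∃ q q', Rep (l k) q ∧ Rep (linv k) q' ∧ q * q' = 1 ∧ 0 < q ∧ q < a)
    (hr : ∀ k, ∃ q q', Rep (r k) q ∧ Rep (rinv k) q' ∧ q * q' = 1 ∧ a < q) (n : ℕ) :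
    (∀ z, Mem z (invSeq p l linv r rinv n).1 → ∃ c, Rep z c ∧ a * c < 1) ∧
      (∀ z, Mem z (invSeq p l linv r rinv n).2 → ∃ c, Rep z c ∧ 1 < a * c) := by
  have step : ∀ {q q' c : Number.{u}}, q * q' = 1 →
      q * (1 - a * ((1 + (q - a) * c) * q')) = (q - a) * (1 - a * c) := by
    intro q q' c h
    linear_combination (-a * (1 + (q - a) * c)) * h
  induction n with
  | zero =>
    refine ⟨?_, by rintro _ ⟨⟨⟩, _⟩⟩
    rintro _ ⟨_, rfl⟩
    exact ⟨0, Rep.zero, by simp⟩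
  | succ n ih =>
    constructor
    · intro z hz
      rcases mem_union.1 hz with hz | hz
      · rcases mem_union.1 hz with hz | hz
        · exact ih.1 z hz
        · obtain ⟨k, y, hy, rfl⟩ := mem_invStep.1 hz
          obtain ⟨c, hc, hlt⟩ := ih.1 y hy
          obtain ⟨q, q', hq, hq', e, haq⟩ := hr k
          refine ⟨_, (Rep.one.add ((hq.sub hp).mul hc)).mul hq', sub_pos.1 ?_⟩
          refine pos_of_mul_pos_right ?_ (ha.trans haq).le
          rw [step e]
          exact _root_.mul_pos (sub_pos.2 haq) (sub_pos.2 hlt)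
      · obtain ⟨k, y, hy, rfl⟩ := mem_invStep.1 hz
        obtain ⟨c, hc, hlt⟩ := ih.2 y hy
        obtain ⟨q, q', hq, hq', e, h0, hqa⟩ := hl k
        refine ⟨_, (Rep.one.add ((hq.sub hp).mul hc)).mul hq', sub_pos.1 ?_⟩
        refine pos_of_mul_pos_right ?_ h0.le
        rw [step e]
        exact mul_pos_of_neg_of_neg (sub_neg.2 hqa) (sub_neg.2 hlt)
    · intro z hz
      rcases mem_union.1 hz with hz | hz
      · rcases mem_union.1 hz with hz | hz
        · exact ih.2 z hz
        · obtain ⟨k, y, hy, rfl⟩ := mem_invStep.1 hz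
          obtain ⟨c, hc, hlt⟩ := ih.1 y hy
          obtain ⟨q, q', hq, hq', e, h0, hqa⟩ := hl k
          refine ⟨_, (Rep.one.add ((hq.sub hp).mul hc)).mul hq', sub_neg.1 ?_⟩
          refine neg_of_mul_neg_right ?_ h0.le
          rw [step e]
          exact mul_neg_of_neg_of_pos (sub_neg.2 hqa) (sub_pos.2 hlt)
      · obtain ⟨k, y, hy, rfl⟩ := mem_invStep.1 hz
        obtain ⟨c, hc, hlt⟩ := ih.2 y hy
        obtain ⟨q, q', hq, hq', e, haq⟩ := hr k
        refine ⟨_, (Rep.one.add ((hq.sub hp).mul hc)).mul hq', sub_neg.1 ?_⟩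
        refine neg_of_mul_neg_right ?_ (ha.trans haq).le
        rw [step e]
        exact mul_neg_of_pos_of_neg (sub_pos.2 haq) (sub_neg.2 hlt)

/-- The limit of `invSeq`, for a game `p` all of whose options apart from a left option `0` are
listed by `l` and `r`, is an inverse of `p`. -/
theorem rep_invSeq_limit {p : Game.{u}} {a : Number.{u}} (hp : Rep p a) {κ μ : Type u}
    {l linv : κ → Game.{u}} {r rinv : μ → Game.{u}}
    (hpl : ∀ z, Opt true z p ↔ z = 0 ∨ ∃ k, z = l k) (hpr : ∀ z, Opt false z p ↔ ∃ k, z = r k)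
    (hl : ∀ k, ∃ q q', Rep (l k) q ∧ Rep (linv k) q' ∧ q * q' = 1 ∧ 0 < q)
    (hr : ∀ k, ∃ q q', Rep (r k) q ∧ Rep (rinv k) q' ∧ q * q' = 1) :
    ∃ b, Rep (ofFam (iUnion fun n => (invSeq p l linv r rinv n).1)
      (iUnion fun n => (invSeq p l linv r rinv n).2)) b ∧ a * b = 1 := by
  have ha : 0 < a := hp.left_lt ((hpl 0).2 (.inl rfl)) Rep.zero
  have hl' : ∀ k, ∃ q q', Rep (l k) q ∧ Rep (linv k) q' ∧ q * q' = 1 ∧ 0 < q ∧ q < a := by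
    intro k
    obtain ⟨q, q', h, h', e, h0⟩ := hl k
    exact ⟨q, q', h, h', e, h0, hp.left_lt ((hpl _).2 (.inr ⟨k, rfl⟩)) h⟩
  have hr' : ∀ k, ∃ q q', Rep (r k) q ∧ Rep (rinv k) q' ∧ q * q' = 1 ∧ a < q := by
    intro k
    obtain ⟨q, q', h, h', e⟩ := hr k
    exact ⟨q, q', h, h', e, hp.lt_right ((hpr _).2 ⟨k, rfl⟩) h⟩
  have spec := invSeq_spec hp ha hl' hr'
  set y := ofFam (iUnion fun n => (invSeq p l linv r rinv n).1)
      (iUnion fun n => (invSeq p l linv r rinv n).2) with hy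
  have memL : ∀ z, Opt true z y ↔ ∃ n, Mem z (invSeq p l linv r rinv n).1 := fun z => mem_iUnion
  have memR : ∀ z, Opt false z y ↔ ∃ n, Mem z (invSeq p l linv r rinv n).2 := fun z => mem_iUnion
  have optL : ∀ z, Opt true z y → ∃ c, Rep z c ∧ a * c < 1 := fun z hz => by
    obtain ⟨n, hn⟩ := (memL z).1 hz
    exact (spec n).1 z hn
  have optR : ∀ z, Opt false z y → ∃ c, Rep z c ∧ 1 < a * c := fun z hz => by
    obtain ⟨n, hn⟩ := (memR z).1 hz
    exact (spec n).2 z hn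
  have ys : y.IsSurreal := by
    refine isSurreal_of_rep (fun z w hz hw => ?_) fun s z hz => ?_
    · obtain ⟨c, hc, h⟩ := optL z hz
      obtain ⟨d, hd, h'⟩ := optR w hw
      exact ⟨c, d, hc, hd, lt_of_mul_lt_mul_left (h.trans h') ha.le⟩
    · cases s
      · obtain ⟨c, hc, -⟩ := optR z hz
        exact hc.1
      · obtain ⟨c, hc, -⟩ := optL z hz
        exact hc.1
  obtain ⟨b, hb⟩ := ys.exists_rep
  have stepRL : ∀ k z, Opt true z y → Opt true ((1 + (r k - p) * z) * rinv k) y := fun k z hz => by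
    obtain ⟨n, hn⟩ := (memL z).1 hz
    exact (memL _).2 ⟨n + 1, mem_union.2 (.inl (mem_union.2 (.inr (mem_invStep.2 ⟨k, z, hn, rfl⟩))))⟩
  have stepLR : ∀ k z, Opt false z y → Opt true ((1 + (l k - p) * z) * linv k) y := fun k z hz => by
    obtain ⟨n, hn⟩ := (memR z).1 hz
    exact (memL _).2 ⟨n + 1, mem_union.2 (.inr (mem_invStep.2 ⟨k, z, hn, rfl⟩))⟩
  have stepLL : ∀ k z, Opt true z y → Opt false ((1 + (l k - p) * z) * linv k) y := fun k z hz => by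
    obtain ⟨n, hn⟩ := (memL z).1 hz
    exact (memR _).2 ⟨n + 1, mem_union.2 (.inl (mem_union.2 (.inr (mem_invStep.2 ⟨k, z, hn, rfl⟩))))⟩
  have stepRR : ∀ k z, Opt false z y → Opt false ((1 + (r k - p) * z) * rinv k) y := fun k z hz => by
    obtain ⟨n, hn⟩ := (memR z).1 hz
    exact (memR _).2 ⟨n + 1, mem_union.2 (.inr (mem_invStep.2 ⟨k, z, hn, rfl⟩))⟩
  -- An option of `p * y` differs from `1` by `q` times the difference between `b` and the newly
  -- generated option of `y`, so its position relative to `1` is read off from the side of that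
  -- option.
  have value : ∀ {q q' c : Number.{u}}, q * q' = 1 →
      q * b + a * c - q * c - 1 = q * (b - (1 + (q - a) * c) * q') := by
    intro q q' c e
    linear_combination (1 + (q - a) * c) * e
  -- This gives `0 < b`, hence `0 < a * b`, as the left option `0` of `1` requires.
  have zero_left : Opt true 0 y := (memL 0).2 ⟨0, ⟨⟩, rfl⟩
  refine ⟨b, hb, le_antisymm ((hp.mul hb).le_of_opt Rep.one (fun z hz => ?_) fun z hz => ?_)
    (Rep.one.le_of_opt (hp.mul hb) (fun z hz => ?_) fun z hz => ?_)⟩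
  · obtain ⟨t, p', y', hp', hy', rfl⟩ := opt_mul.1 hz
    cases t
    · obtain ⟨k, rfl⟩ := (hpr p').1 hp'
      obtain ⟨q, q', hq, hq', e, haq⟩ := hr' k
      obtain ⟨c, hc, -⟩ := optR y' hy'
      refine ⟨_, ((hq.mul hb).add (hp.mul hc)).sub (hq.mul hc), sub_neg.1 ?_⟩
      rw [value e]
      exact mul_neg_of_pos_of_neg (ha.trans haq) (sub_neg.2 (hb.lt_right (stepRR k y' hy')
        ((Rep.one.add ((hq.sub hp).mul hc)).mul hq')))
    · obtain ⟨c, hc, hlt⟩ := optL y' hy'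
      rcases (hpl p').1 hp' with rfl | ⟨k, rfl⟩
      · exact ⟨_, ((Rep.zero.mul hb).add (hp.mul hc)).sub (Rep.zero.mul hc), by simpa using hlt⟩
      · obtain ⟨q, q', hq, hq', e, h0, haq⟩ := hl' k
        refine ⟨_, ((hq.mul hb).add (hp.mul hc)).sub (hq.mul hc), sub_neg.1 ?_⟩
        rw [value e]
        exact mul_neg_of_pos_of_neg h0 (sub_neg.2 (hb.lt_right (stepLL k y' hy')
          ((Rep.one.add ((hq.sub hp).mul hc)).mul hq')))
  · exact absurd (opt_one.1 hz).1 (by decide)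
  · obtain ⟨-, rfl⟩ := opt_one.1 hz
    exact ⟨0, Rep.zero, _root_.mul_pos ha (hb.left_lt zero_left Rep.zero)⟩
  · obtain ⟨t, p', y', hp', hy', rfl⟩ := opt_mul.1 hz
    cases t
    · obtain ⟨k, rfl⟩ := (hpr p').1 hp'
      obtain ⟨q, q', hq, hq', e, haq⟩ := hr' k
      obtain ⟨c, hc, -⟩ := optL y' hy'
      refine ⟨_, ((hq.mul hb).add (hp.mul hc)).sub (hq.mul hc), sub_pos.1 ?_⟩
      rw [value e]
      exact _root_.mul_pos (ha.trans haq) (sub_pos.2 (hb.left_lt (stepRL k y' hy')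
        ((Rep.one.add ((hq.sub hp).mul hc)).mul hq')))
    · obtain ⟨c, hc, hlt⟩ := optR y' hy'
      rcases (hpl p').1 hp' with rfl | ⟨k, rfl⟩
      · exact ⟨_, ((Rep.zero.mul hb).add (hp.mul hc)).sub (Rep.zero.mul hc), by simpa using hlt⟩
      · obtain ⟨q, q', hq, hq', e, h0, haq⟩ := hl' k
        refine ⟨_, ((hq.mul hb).add (hp.mul hc)).sub (hq.mul hc), sub_pos.1 ?_⟩
        rw [value e]
        exact _root_.mul_pos h0 (sub_pos.2 (hb.left_lt (stepLR k y' hy')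
          ((Rep.one.add ((hq.sub hp).mul hc)).mul hq')))

theorem Rep.exists_rep_invPos {x : Game.{u}} {a : Number.{u}} (hx : Rep x a) (ha : 0 < a) :
    ∃ b, Rep (invPos x) b ∧ a * b = 1 := by
  induction x generalizing a with
  | mk α β L R ihL ihR =>
    have sL : ∀ i, (L i).IsSurreal := fun i => hx.1.opt (s := true) ⟨i, rfl⟩
    have sR : ∀ j, (R j).IsSurreal := fun j => hx.1.opt (s := false) ⟨j, rfl⟩
    have hL : ∀ i q, Rep (L i) q → q < a := fun i q => hx.left_lt ⟨i, rfl⟩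
    have hR : ∀ j q, Rep (R j) q → a < q := fun j q => hx.lt_right ⟨j, rfl⟩
    let l : {i : α // 0 < L i} → Game.{u} := fun i => L i
    let r : {j : β // 0 < R j} → Game.{u} := fun j => R j
    let p : Game.{u} := mk (Option {i : α // 0 < L i}) {j : β // 0 < R j} (fun o => o.elim 0 l) r
    have hpl : ∀ z, Opt true z p ↔ z = 0 ∨ ∃ k, z = l k := fun z =>
      ⟨by rintro ⟨_ | k, rfl⟩; exacts [.inl rfl, .inr ⟨k, rfl⟩],
        by rintro (rfl | ⟨k, rfl⟩); exacts [⟨none, rfl⟩, ⟨some k, rfl⟩]⟩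
    have hpr : ∀ z, Opt false z p ↔ ∃ k, z = r k := fun z =>
      ⟨by rintro ⟨k, rfl⟩; exact ⟨k, rfl⟩, by rintro ⟨k, rfl⟩; exact ⟨k, rfl⟩⟩
    have sp : p.IsSurreal := by
      refine isSurreal_of_rep (fun z w hz hw => ?_) fun s z hz => ?_
      · obtain ⟨k, rfl⟩ := (hpr w).1 hw
        obtain ⟨d, hd⟩ := (sR k.1).exists_rep
        rcases (hpl z).1 hz with rfl | ⟨i, rfl⟩
        · exact ⟨0, d, Rep.zero, hd, ha.trans (hR _ _ hd)⟩
        · obtain ⟨c, hc⟩ := (sL i.1).exists_rep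
          exact ⟨c, d, hc, hd, (hL _ _ hc).trans (hR _ _ hd)⟩
      · cases s
        · obtain ⟨k, rfl⟩ := (hpr z).1 hz
          exact sR _
        · rcases (hpl z).1 hz with rfl | ⟨i, rfl⟩
          exacts [isSurreal_zero, sL _]
    obtain ⟨a', hp⟩ := sp.exists_rep
    -- As `x > 0`, adding the left option `0` and dropping the nonpositive left options keeps the
    -- value. All right options are positive, so none is dropped.
    have e : a' = a := by
      refine le_antisymm (hp.le_of_opt hx (fun z hz => ?_) fun z hz => ?_)
        (hx.le_of_opt hp (fun z hz => ?_) fun z hz => ?_)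
      · rcases (hpl z).1 hz with rfl | ⟨i, rfl⟩
        · exact ⟨0, Rep.zero, ha⟩
        · obtain ⟨c, hc⟩ := (sL i.1).exists_rep
          exact ⟨c, hc, hL _ _ hc⟩
      · obtain ⟨j, rfl⟩ := hz
        obtain ⟨c, hc⟩ := (sR j).exists_rep
        exact ⟨c, hc, hp.lt_right ((hpr _).2
          ⟨⟨j, (Rep.zero.lt_iff_lt hc).2 (ha.trans (hR _ _ hc))⟩, rfl⟩) hc⟩
      · obtain ⟨i, rfl⟩ := hz
        obtain ⟨c, hc⟩ := (sL i).exists_rep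
        refine ⟨c, hc, ?_⟩
        rcases lt_or_ge 0 c with h | h
        · exact hp.left_lt ((hpl _).2 (.inr ⟨⟨i, (Rep.zero.lt_iff_lt hc).2 h⟩, rfl⟩)) hc
        · exact h.trans_lt (hp.left_lt ((hpl 0).2 (.inl rfl)) Rep.zero)
      · obtain ⟨k, rfl⟩ := (hpr z).1 hz
        obtain ⟨c, hc⟩ := (sR k.1).exists_rep
        exact ⟨c, hc, hR _ _ hc⟩
    subst e
    refine rep_invSeq_limit (linv := fun i : {i : α // 0 < L i} => invPos (L i))
      (rinv := fun j : {j : β // 0 < R j} => invPos (R j)) hp hpl hpr (fun k => ?_) fun k => ?_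
    · obtain ⟨c, hc⟩ := (sL k.1).exists_rep
      have h0 := (Rep.zero.lt_iff_lt hc).1 k.2
      obtain ⟨d, hd, e⟩ := ihL k.1 hc h0
      exact ⟨c, d, hc, hd, e, h0⟩
    · obtain ⟨c, hc⟩ := (sR k.1).exists_rep
      obtain ⟨d, hd, e⟩ := ihR k.1 hc ((Rep.zero.lt_iff_lt hc).1 k.2)
      exact ⟨c, d, hc, hd, e⟩

theorem Number.exists_mul_eq_one {a : Number.{u}} (ha : a ≠ 0) : ∃ b, a * b = 1 := by
  rcases lt_or_gt_of_ne ha with h | h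
  · obtain ⟨x, hx⟩ := (-a).exists_rep
    obtain ⟨b, -, e⟩ := hx.exists_rep_invPos (neg_pos.2 h)
    exact ⟨-b, by rw [mul_neg, ← neg_mul, e]⟩
  · obtain ⟨x, hx⟩ := a.exists_rep
    obtain ⟨b, -, e⟩ := hx.exists_rep_invPos h
    exact ⟨b, e⟩

open Classical in
instance : Field Number.{u} where
  inv a := if h : a = 0 then 0 else (Number.exists_mul_eq_one h).choose
  mul_inv_cancel a h := by
    rw [dif_neg h]
    exact (Number.exists_mul_eq_one h).choose_spec
  inv_zero := dif_pos rfl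
  nnqsmul := _
  nnqsmul_def := fun _ _ => rfl
  qsmul := _
  qsmul_def := fun _ _ => rfl

/-- The inverse in `Number` was chosen abstractly. Uniqueness of inverses identifies it with the
value of the recursive construction. -/
theorem Rep.inv {x : Game.{u}} {a : Number.{u}} (h : Rep x a) : Rep x⁻¹ a⁻¹ := by
  classical
  change Rep (if 0 < x then invPos x else if x < 0 then -invPos (-x) else 0) a⁻¹
  simp only [Rep.zero.lt_iff_lt h, h.lt_iff_lt Rep.zero]
  split_ifs with h₁ h₂
  · obtain ⟨b, hb, e⟩ := h.exists_rep_invPos h₁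
    rwa [← eq_inv_of_mul_eq_one_right e]
  · obtain ⟨b, hb, e⟩ := h.neg.exists_rep_invPos (neg_pos.2 h₂)
    rw [← eq_inv_of_mul_eq_one_right (b := -b) (by rw [mul_neg, ← neg_mul, e])]
    exact hb.neg
  · rw [le_antisymm (not_lt.1 h₁) (not_lt.1 h₂), inv_zero]
    exact Rep.zero

theorem Rep.div {x y : Game.{u}} {a b : Number.{u}} (h : Rep x a) (h' : Rep y b) :
    Rep (x / y) (a / b) := by
  rw [div_eq_mul_inv]
  exact h.mul h'.inv

/-! ### Square roots -/

theorem opt_true_sqrtClosure {x z : Game.{u}} {A B : Fam.{u}} :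
    Opt true z (sqrtClosure x A B) ↔ ∃ n, Mem z (sqrtSeq x A B n).1 := mem_iUnion

theorem opt_false_sqrtClosure {x z : Game.{u}} {A B : Fam.{u}} :
    Opt false z (sqrtClosure x A B) ↔ ∃ n, Mem z (sqrtSeq x A B n).2 := mem_iUnion

theorem sqrtSeq_monotone (x : Game.{u}) (A B : Fam.{u}) {m n : ℕ} (h : m ≤ n) {z : Game.{u}} :
    (Mem z (sqrtSeq x A B m).1 → Mem z (sqrtSeq x A B n).1) ∧
      (Mem z (sqrtSeq x A B m).2 → Mem z (sqrtSeq x A B n).2) := by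
  induction n, h using Nat.le_induction with
  | base => exact ⟨id, id⟩
  | succ n _ ih =>
    exact ⟨fun hz => mem_union.2 (.inl (ih.1 hz)),
      fun hz => mem_union.2 (.inl (mem_union.2 (.inl (ih.2 hz))))⟩

theorem sqrtClosure_step {x y z : Game.{u}} {A B : Fam.{u}} {s t : Bool}
    (hy : Opt s y (sqrtClosure x A B)) (hz : Opt t z (sqrtClosure x A B)) (h : ¬ 0 ≈ y + z) :
    (s = t → Opt false ((x + y * z) / (y + z)) (sqrtClosure x A B)) ∧
      (s = true → t = false → Opt true ((x + y * z) / (y + z)) (sqrtClosure x A B)) := by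
  cases s <;> cases t <;> simp only [forall_const, reduceCtorEq, false_imp_iff, true_and, and_true,
    implies_true, opt_true_sqrtClosure, opt_false_sqrtClosure] at hy hz ⊢ <;>
    obtain ⟨m, hm⟩ := hy <;> obtain ⟨n, hn⟩ := hz
  -- The two options may arise at different stages, so both are moved to stage `max m n` before the
  -- step is applied.
  · exact ⟨max m n + 1, mem_union.2 (.inr (mem_sqrtStep.2 ⟨y, z,
      (sqrtSeq_monotone x A B (le_max_left m n)).2 hm,
      (sqrtSeq_monotone x A B (le_max_right m n)).2 hn, h, rfl⟩))⟩
  · exact ⟨max m n + 1, mem_union.2 (.inr (mem_sqrtStep.2 ⟨y, z,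
      (sqrtSeq_monotone x A B (le_max_left m n)).1 hm,
      (sqrtSeq_monotone x A B (le_max_right m n)).2 hn, h, rfl⟩))⟩
  · exact ⟨max m n + 1, mem_union.2 (.inl (mem_union.2 (.inr (mem_sqrtStep.2 ⟨y, z,
      (sqrtSeq_monotone x A B (le_max_left m n)).1 hm,
      (sqrtSeq_monotone x A B (le_max_right m n)).1 hn, h, rfl⟩))))⟩

/-- `((x + c d) / (c + d))² - x = (x - c²) (x - d²) / (c + d)²`. -/
theorem sqrtStep_sq_sub {K : Type*} [Field K] {a c d : K} (h : c + d ≠ 0) :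
    (a + c * d) / (c + d) * ((a + c * d) / (c + d)) - a =
      (a - c * c) * (a - d * d) / ((c + d) * (c + d)) := by
  field_simp
  ring

/-- The sign of `(a - c²)(a - d²)` in `sqrtStep_sq_sub` decides the side: mixed factors stay below
`a`, and factors of the same side give a square above `a`. -/
theorem sqrtSeq_spec {x : Game.{u}} {a : Number.{u}} (hx : Rep x a) (ha : 0 ≤ a) {A B : Fam.{u}}
    (hA : ∀ z, Mem z A → ∃ c, Rep z c ∧ 0 ≤ c ∧ c * c < a)
    (hB : ∀ z, Mem z B → ∃ c, Rep z c ∧ 0 ≤ c ∧ a < c * c) (n : ℕ) :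
    (∀ z, Mem z (sqrtSeq x A B n).1 → ∃ c, Rep z c ∧ 0 ≤ c ∧ c * c < a) ∧
      (∀ z, Mem z (sqrtSeq x A B n).2 → ∃ c, Rep z c ∧ 0 ≤ c ∧ a < c * c) := by
  induction n with
  | zero => exact ⟨hA, hB⟩
  | succ n ih =>
    constructor
    · intro z hz
      rcases mem_union.1 hz with hz | hz
      · exact ih.1 z hz
      · obtain ⟨y, w, hy, hw, hne, rfl⟩ := mem_sqrtStep.1 hz
        obtain ⟨c, hc, c0, hlt⟩ := ih.1 y hy
        obtain ⟨d, hd, d0, hgt⟩ := ih.2 w hw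
        have hne : c + d ≠ 0 := fun e => hne ((Rep.zero.equiv_iff_eq (hc.add hd)).2 e.symm)
        refine ⟨_, (hx.add (hc.mul hd)).div (hc.add hd), by positivity, ?_⟩
        rw [← sub_neg, sqrtStep_sq_sub hne]
        exact div_neg_of_neg_of_pos (mul_neg_of_pos_of_neg (sub_pos.2 hlt) (sub_neg.2 hgt))
          (mul_self_pos.2 hne)
    · intro z hz
      rcases mem_union.1 hz with hz | hz
      · rcases mem_union.1 hz with hz | hz
        · exact ih.2 z hz
        · obtain ⟨y, w, hy, hw, hne, rfl⟩ := mem_sqrtStep.1 hz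
          obtain ⟨c, hc, c0, hlt⟩ := ih.1 y hy
          obtain ⟨d, hd, d0, hlt'⟩ := ih.1 w hw
          have hne : c + d ≠ 0 := fun e => hne ((Rep.zero.equiv_iff_eq (hc.add hd)).2 e.symm)
          refine ⟨_, (hx.add (hc.mul hd)).div (hc.add hd), by positivity, ?_⟩
          rw [← sub_pos, sqrtStep_sq_sub hne]
          exact div_pos (_root_.mul_pos (sub_pos.2 hlt) (sub_pos.2 hlt')) (mul_self_pos.2 hne)
      · obtain ⟨y, w, hy, hw, hne, rfl⟩ := mem_sqrtStep.1 hz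
        obtain ⟨c, hc, c0, hlt⟩ := ih.2 y hy
        obtain ⟨d, hd, d0, hlt'⟩ := ih.2 w hw
        have hne : c + d ≠ 0 := fun e => hne ((Rep.zero.equiv_iff_eq (hc.add hd)).2 e.symm)
        refine ⟨_, (hx.add (hc.mul hd)).div (hc.add hd), by positivity, ?_⟩
        rw [← sub_pos, sqrtStep_sq_sub hne]
        exact div_pos (mul_pos_of_neg_of_neg (sub_neg.2 hlt) (sub_neg.2 hlt')) (mul_self_pos.2 hne)

/-- `√(x, A, B)` is a square root of `x ≥ 0` when `A`, `B` consist of nonnegative numbers, with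
squares below and above `x` respectively, such that every nonnegative left option of `x` is at
most a square from `A`, and every right option of `x` is at least a square from `B`. -/
theorem rep_sqrtClosure {x : Game.{u}} {a : Number.{u}} (hx : Rep x a) (ha : 0 ≤ a) {A B : Fam.{u}}
    (hA : ∀ z, Mem z A → ∃ c, Rep z c ∧ 0 ≤ c ∧ c * c < a)
    (hB : ∀ z, Mem z B → ∃ c, Rep z c ∧ 0 ≤ c ∧ a < c * c)
    (hxA : ∀ z c, Opt true z x → Rep z c → 0 ≤ c → ∃ w d, Mem w A ∧ Rep w d ∧ c ≤ d * d)
    (hxB : ∀ z c, Opt false z x → Rep z c → ∃ w d, Mem w B ∧ Rep w d ∧ d * d ≤ c) :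
    ∃ b, Rep (sqrtClosure x A B) b ∧ 0 ≤ b ∧ b * b = a := by
  have spec := sqrtSeq_spec hx ha hA hB
  set y := sqrtClosure x A B with hy
  have optL : ∀ z, Opt true z y → ∃ c, Rep z c ∧ 0 ≤ c ∧ c * c < a := fun z hz => by
    obtain ⟨n, hn⟩ := opt_true_sqrtClosure.1 hz
    exact (spec n).1 z hn
  have optR : ∀ z, Opt false z y → ∃ c, Rep z c ∧ 0 ≤ c ∧ a < c * c := fun z hz => by
    obtain ⟨n, hn⟩ := opt_false_sqrtClosure.1 hz
    exact (spec n).2 z hn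
  have memA : ∀ z, Mem z A → Opt true z y := fun z hz => opt_true_sqrtClosure.2 ⟨0, hz⟩
  have memB : ∀ z, Mem z B → Opt false z y := fun z hz => opt_false_sqrtClosure.2 ⟨0, hz⟩
  have ys : y.IsSurreal := by
    refine isSurreal_of_rep (fun z w hz hw => ?_) fun s z hz => ?_
    · obtain ⟨c, hc, -, h⟩ := optL z hz
      obtain ⟨d, hd, d0, h'⟩ := optR w hw
      exact ⟨c, d, hc, hd, lt_of_mul_self_lt_mul_self₀ d0 (h.trans h')⟩
    · cases s
      · obtain ⟨c, hc, -⟩ := optR z hz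
        exact hc.1
      · obtain ⟨c, hc, -⟩ := optL z hz
        exact hc.1
  obtain ⟨b, hb⟩ := ys.exists_rep
  have b0 : 0 ≤ b := by
    refine Rep.zero.le_of_opt hb (fun z hz => (opt_zero hz).elim) fun z hz => ?_
    obtain ⟨c, hc, c0, h⟩ := optR z hz
    exact ⟨c, hc, c0.lt_of_ne (by rintro rfl; rw [mul_zero] at h; exact h.not_ge ha)⟩
  refine ⟨b, hb, b0, le_antisymm ((hb.mul hb).le_of_opt hx (fun z hz => ?_) fun z hz => ?_)
    (hx.le_of_opt (hb.mul hb) (fun z hz => ?_) fun z hz => ?_)⟩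
  · obtain ⟨t, v, w, hv, hw, rfl⟩ := opt_mul.1 hz
    -- Here `v` and `w` lie on the same side. If `c + d > 0`, the claim `cb + bd - cd < a` says that
    -- `b` is below the right option `(a + cd)/(c + d)`. If `c + d = 0`, no such option is
    -- generated, but the claim becomes `0 < a`: right options are excluded since `a < c²`, and for
    -- left options it is `c² < a`.
    have key : ∃ c d, Rep v c ∧ Rep w d ∧ 0 ≤ c ∧ 0 ≤ d ∧ (c + d = 0 → c * c < a) := by
      cases t
      · obtain ⟨c, hc, c0, h⟩ := optR v hv
        obtain ⟨d, hd, d0, -⟩ := optR w hw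
        refine ⟨c, d, hc, hd, c0, d0, fun e => absurd ?_ h.not_ge⟩
        have : c = 0 := by linarith
        rwa [this, mul_zero]
      · obtain ⟨c, hc, c0, h⟩ := optL v hv
        obtain ⟨d, hd, d0, -⟩ := optL w hw
        exact ⟨c, d, hc, hd, c0, d0, fun _ => h⟩
    obtain ⟨c, d, hc, hd, c0, d0, h⟩ := key
    refine ⟨_, ((hc.mul hb).add (hb.mul hd)).sub (hc.mul hd), ?_⟩
    rcases (add_nonneg c0 d0).eq_or_lt' with e | e
    · have hc0 : c = 0 := by linarith
      have hd0 : d = 0 := by linarith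
      have := h e
      simp only [hc0, hd0, zero_mul, mul_zero, add_zero, sub_zero] at this ⊢
      exact this
    · have lt := hb.lt_right ((sqrtClosure_step hv hw
        fun h => e.ne ((Rep.zero.equiv_iff_eq (hc.add hd)).1 h)).1 (by cases t <;> rfl))
        ((hx.add (hc.mul hd)).div (hc.add hd))
      rw [lt_div_iff₀ e] at lt
      linarith
  · obtain ⟨c, hc⟩ := (hx.1.opt hz).exists_rep
    obtain ⟨w, d, hw, hd, hle⟩ := hxB z c hz hc
    exact ⟨c, hc, (mul_self_lt_mul_self b0 (hb.lt_right (memB w hw) hd)).trans_le hle⟩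
  · obtain ⟨c, hc⟩ := (hx.1.opt hz).exists_rep
    refine ⟨c, hc, ?_⟩
    rcases lt_or_ge c 0 with h | h
    · exact h.trans_le (mul_self_nonneg b)
    · obtain ⟨w, d, hw, hd, hle⟩ := hxA z c hz hc h
      obtain ⟨d', hd', d0, -⟩ := hA w hw
      obtain rfl := hd.unique hd'
      exact hle.trans_lt (mul_self_lt_mul_self d0 (hb.left_lt (memA w hw) hd))
  · obtain ⟨t, v, w, hv, hw, rfl⟩ := opt_mul.1 hz
    -- Now `v` and `w` lie on opposite sides, so `c + d > 0` because the right one exceeds the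
    -- nonnegative left one. The generated left option lists the left factor first, hence the swap
    -- in the first case.
    have key : ∃ c d, Rep v c ∧ Rep w d ∧ 0 < c + d ∧ (a + c * d) / (c + d) < b := by
      cases t
      · obtain ⟨c, hc, c0, h⟩ := optR v hv
        obtain ⟨d, hd, d0, h'⟩ := optL w hw
        have e : 0 < d + c := by linarith [lt_of_mul_self_lt_mul_self₀ c0 (h'.trans h)]
        have lt := hb.left_lt ((sqrtClosure_step hw hv
          fun h => e.ne ((Rep.zero.equiv_iff_eq (hd.add hc)).1 h)).2 rfl rfl)
          ((hx.add (hd.mul hc)).div (hd.add hc))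
        rw [mul_comm, add_comm d] at lt
        exact ⟨c, d, hc, hd, by linarith, lt⟩
      · obtain ⟨c, hc, c0, h⟩ := optL v hv
        obtain ⟨d, hd, d0, h'⟩ := optR w hw
        have e : 0 < c + d := by linarith [lt_of_mul_self_lt_mul_self₀ d0 (h.trans h')]
        have lt := hb.left_lt ((sqrtClosure_step hv hw
          fun h => e.ne ((Rep.zero.equiv_iff_eq (hc.add hd)).1 h)).2 rfl rfl)
          ((hx.add (hc.mul hd)).div (hc.add hd))
        exact ⟨c, d, hc, hd, e, lt⟩
    obtain ⟨c, d, hc, hd, e, lt⟩ := key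
    refine ⟨_, ((hc.mul hb).add (hb.mul hd)).sub (hc.mul hd), ?_⟩
    rw [div_lt_iff₀ e] at lt
    linarith

theorem Rep.exists_rep_sqrt {x : Game.{u}} {a : Number.{u}} (hx : Rep x a) (ha : 0 ≤ a) :
    ∃ b, Rep (sqrt x) b ∧ 0 ≤ b ∧ b * b = a := by
  induction x generalizing a with
  | mk α β L R ihL ihR =>
    refine rep_sqrtClosure hx ha ?_ ?_ ?_ ?_
    · rintro _ ⟨i, rfl⟩
      obtain ⟨c, hc⟩ := (hx.1.opt (s := true) ⟨i.1, rfl⟩).exists_rep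
      obtain ⟨d, hd, d0, rfl⟩ := ihL i.1 hc ((Rep.zero.le_iff_le hc).1 i.2)
      exact ⟨d, hd, d0, hx.left_lt ⟨i.1, rfl⟩ hc⟩
    · rintro _ ⟨j, rfl⟩
      obtain ⟨c, hc⟩ := (hx.1.opt (s := false) ⟨j.1, rfl⟩).exists_rep
      obtain ⟨d, hd, d0, rfl⟩ := ihR j.1 hc ((Rep.zero.le_iff_le hc).1 j.2)
      exact ⟨d, hd, d0, hx.lt_right ⟨j.1, rfl⟩ hc⟩
    · rintro _ c ⟨i, rfl⟩ hc h
      obtain ⟨d, hd, -, e⟩ := ihL i hc h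
      exact ⟨_, d, ⟨⟨i, (Rep.zero.le_iff_le hc).2 h⟩, rfl⟩, hd, e.ge⟩
    · rintro _ c ⟨j, rfl⟩ hc
      -- Right options of a nonnegative number are positive, so restricting to `0 ≤ x^R` discards
      -- none.
      have h := ha.trans (hx.lt_right ⟨j, rfl⟩ hc).le
      obtain ⟨d, hd, -, e⟩ := ihR j hc h
      exact ⟨_, d, ⟨⟨j, (Rep.zero.le_iff_le hc).2 h⟩, rfl⟩, hd, e.le⟩

/-- This serves negative `x`. Every set generated with a factor from `L_n` is empty, so no left
member ever appears and the order condition is vacuous. The right members stay surreal by the field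
operations. -/
theorem isSurreal_sqrtClosure_of_isEmpty {x : Game.{u}} (hx : x.IsSurreal) {A B : Fam.{u}}
    (hA : ∀ z, ¬ Mem z A) (hB : ∀ z, Mem z B → z.IsSurreal) : (sqrtClosure x A B).IsSurreal := by
  have spec : ∀ n, (∀ z, ¬ Mem z (sqrtSeq x A B n).1) ∧
      ∀ z, Mem z (sqrtSeq x A B n).2 → z.IsSurreal := by
    intro n
    induction n with
    | zero => exact ⟨hA, hB⟩
    | succ n ih =>
      constructor
      · intro z hz
        rcases mem_union.1 hz with hz | hz
        · exact ih.1 z hz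
        · obtain ⟨y, -, hy, -⟩ := mem_sqrtStep.1 hz
          exact ih.1 y hy
      · intro z hz
        rcases mem_union.1 hz with hz | hz
        · rcases mem_union.1 hz with hz | hz
          · exact ih.2 z hz
          · obtain ⟨y, -, hy, -⟩ := mem_sqrtStep.1 hz
            exact (ih.1 y hy).elim
        · obtain ⟨y, w, hy, hw, -, rfl⟩ := mem_sqrtStep.1 hz
          obtain ⟨a, ha⟩ := hx.exists_rep
          obtain ⟨c, hc⟩ := (ih.2 y hy).exists_rep
          obtain ⟨d, hd⟩ := (ih.2 w hw).exists_rep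
          exact ((ha.add (hc.mul hd)).div (hc.add hd)).1
  refine isSurreal_iff.2 ⟨fun l r hl => ?_, fun s z hz => ?_⟩
  · obtain ⟨n, hn⟩ := opt_true_sqrtClosure.1 hl
    exact ((spec n).1 l hn).elim
  · cases s
    · obtain ⟨n, hn⟩ := opt_false_sqrtClosure.1 hz
      exact (spec n).2 z hn
    · obtain ⟨n, hn⟩ := opt_true_sqrtClosure.1 hz
      exact ((spec n).1 z hn).elim

theorem IsSurreal.sqrt {x : Game.{u}} (hx : x.IsSurreal) : x.sqrt.IsSurreal := by
  obtain ⟨a, ha⟩ := hx.exists_rep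
  rcases lt_or_ge a 0 with h | h
  · cases x with
    | mk α β L R =>
      refine isSurreal_sqrtClosure_of_isEmpty hx ?_ ?_
      · rintro _ ⟨⟨i, hi⟩, -⟩
        exact (hi.trans_lt ((hx.left_lt ⟨i, rfl⟩).trans ((ha.lt_iff_lt Rep.zero).2 h))).false
      · rintro _ ⟨⟨j, hj⟩, rfl⟩
        obtain ⟨c, hc⟩ := (hx.opt (s := false) ⟨j, rfl⟩).exists_rep
        obtain ⟨d, hd, -⟩ := hc.exists_rep_sqrt ((Rep.zero.le_iff_le hc).1 hj)
        exact hd.1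
  · obtain ⟨b, hb, -⟩ := ha.exists_rep_sqrt h
    exact hb.1

theorem sqrt_mul_self_equiv {x : Game.{u}} (hx : x.IsSurreal) (h : 0 ≤ x) : (x * x).sqrt ≈ x := by
  obtain ⟨a, ha⟩ := hx.exists_rep
  have a0 := (Rep.zero.le_iff_le ha).1 h
  obtain ⟨b, hb, b0, e⟩ := (ha.mul ha).exists_rep_sqrt (mul_self_nonneg a)
  exact (hb.equiv_iff_eq ha).2 ((mul_self_inj b0 a0).1 e)

theorem inv_sqrt_equiv {x : Game.{u}} (hx : x.IsSurreal) (h : 0 < x) : (x.sqrt)⁻¹ ≈ (x⁻¹).sqrt := by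
  obtain ⟨a, ha⟩ := hx.exists_rep
  have a0 := ((Rep.zero.lt_iff_lt ha).1 h).le
  obtain ⟨b, hb, b0, e⟩ := ha.exists_rep_sqrt a0
  obtain ⟨c, hc, c0, e'⟩ := ha.inv.exists_rep_sqrt (inv_nonneg.2 a0)
  refine (hb.inv.equiv_iff_eq hc).2 ((mul_self_inj (inv_nonneg.2 b0) c0).1 ?_)
  rw [e', ← e, mul_inv]

/-! ### Square roots of negative numbers -/

theorem identical_of_opt {x y : Game.{u}} (h : ∀ s z, Opt s z x → ∃ w, Opt s w y ∧ Identical z w)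
    (h' : ∀ s w, Opt s w y → ∃ z, Opt s z x ∧ Identical z w) : Identical x y := by
  cases x
  cases y
  refine ⟨fun i => ?_, fun i => ?_, fun j => ?_, fun j => ?_⟩
  · obtain ⟨_, ⟨i', rfl⟩, e⟩ := h true _ ⟨i, rfl⟩; exact ⟨i', e⟩
  · obtain ⟨_, ⟨i', rfl⟩, e⟩ := h' true _ ⟨i, rfl⟩; exact ⟨i', e⟩
  · obtain ⟨_, ⟨i', rfl⟩, e⟩ := h false _ ⟨j, rfl⟩; exact ⟨i', e⟩
  · obtain ⟨_, ⟨i', rfl⟩, e⟩ := h' false _ ⟨j, rfl⟩; exact ⟨i', e⟩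

/-- The left sets stay empty, and the condition `a + b ≉ 0` empties `S(x, R_n, R_n)`, so the
recursion stops at stage `0`. -/
theorem sqrtClosure_empty {x : Game.{u}} {A B : Fam.{u}} (hA : ∀ z, ¬ Mem z A)
    (hB : ∀ y z, Mem y B → Mem z B → 0 ≈ y + z) :
    (∀ z, ¬ Opt true z (sqrtClosure x A B)) ∧ ∀ z, Opt false z (sqrtClosure x A B) ↔ Mem z B := by
  have spec : ∀ n, (∀ z, ¬ Mem z (sqrtSeq x A B n).1) ∧
      ∀ z, Mem z (sqrtSeq x A B n).2 → Mem z B := by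
    intro n
    induction n with
    | zero => exact ⟨hA, fun _ => id⟩
    | succ n ih =>
      constructor
      · intro z hz
        rcases mem_union.1 hz with hz | hz
        · exact ih.1 z hz
        · obtain ⟨y, -, hy, -⟩ := mem_sqrtStep.1 hz
          exact ih.1 y hy
      · intro z hz
        rcases mem_union.1 hz with hz | hz
        · rcases mem_union.1 hz with hz | hz
          · exact ih.2 z hz
          · obtain ⟨y, -, hy, -⟩ := mem_sqrtStep.1 hz
            exact (ih.1 y hy).elim
        · obtain ⟨y, w, hy, hw, hne, -⟩ := mem_sqrtStep.1 hz
          exact (hne (hB y w (ih.2 y hy) (ih.2 w hw))).elim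
  refine ⟨fun z hz => ?_, fun z => ⟨fun hz => ?_, fun hz => opt_false_sqrtClosure.2 ⟨0, hz⟩⟩⟩
  · obtain ⟨n, hn⟩ := opt_true_sqrtClosure.1 hz
    exact (spec n).1 z hn
  · obtain ⟨n, hn⟩ := opt_false_sqrtClosure.1 hz
    exact (spec n).2 z hn

theorem Number.eq_zero_of_mul_self {a : Number.{u}} (h : a * a = 0) : a = 0 :=
  by_contra fun h' => (mul_self_pos.2 h').ne' h

theorem opt_sqrt_of_left_neg {x : Game.{u}} (hl : ∀ z, Opt true z x → ¬ 0 ≤ z)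
    (hr : ∀ y z, Opt false y x → Opt false z x → 0 ≤ y → 0 ≤ z → 0 ≈ sqrt y + sqrt z) :
    (∀ z, ¬ Opt true z (sqrt x)) ∧
      ∀ z, Opt false z (sqrt x) ↔ ∃ r, Opt false r x ∧ 0 ≤ r ∧ z = sqrt r := by
  cases x with
  | mk α β L R =>
    obtain ⟨h, h'⟩ := sqrtClosure_empty (x := mk α β L R)
      (A := ⟨{i : α // 0 ≤ L i}, fun i => sqrt (L i)⟩)
      (B := ⟨{j : β // 0 ≤ R j}, fun j => sqrt (R j)⟩)
      (by rintro _ ⟨⟨i, hi⟩, -⟩; exact hl _ ⟨i, rfl⟩ hi)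
      (by
        rintro _ _ ⟨⟨i, hi⟩, rfl⟩ ⟨⟨j, hj⟩, rfl⟩
        exact hr _ _ ⟨i, rfl⟩ ⟨j, rfl⟩ hi hj)
    refine ⟨h, fun z => (h' z).trans ⟨?_, ?_⟩⟩
    · rintro ⟨⟨j, hj⟩, rfl⟩
      exact ⟨_, ⟨j, rfl⟩, hj, rfl⟩
    · rintro ⟨_, ⟨j, rfl⟩, hj, rfl⟩
      exact ⟨⟨j, hj⟩, rfl⟩

theorem opt_neg_zero {s : Bool} {z : Game.{u}} : ¬ Opt s z (-0) := fun h => by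
  obtain ⟨_, h, -⟩ := opt_neg.1 h
  exact opt_zero h

theorem opt_sqrt_neg_zero {s : Bool} {z : Game.{u}} : ¬ Opt s z (sqrt (-0)) := by
  obtain ⟨h, h'⟩ := opt_sqrt_of_left_neg (x := -0) (fun z hz => (opt_neg_zero hz).elim)
    fun y z hy => (opt_neg_zero hy).elim
  cases s
  · rw [h']
    rintro ⟨r, hr, -⟩
    exact opt_neg_zero hr
  · exact h z

theorem opt_neg_one {s : Bool} {z : Game.{u}} : Opt s z (-1) ↔ s = false ∧ z = -0 := by
  simp [opt_neg, opt_one]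

/-- The only option of `-1` is the right option `-0`. Its root has no options, and two copies of
that root sum to `0`, so nothing further is generated. -/
theorem sqrt_neg_one_identical : Identical (-1 : Game.{u}).sqrt (-1) := by
  have hz : Identical (sqrt (-0 : Game.{u})) (-0) := identical_of_opt
    (fun s z h => (opt_sqrt_neg_zero h).elim) fun s z h => (opt_neg_zero h).elim
  have n0 : Rep (-0 : Game.{u}) 0 := by simpa using Rep.zero.neg
  obtain ⟨b, hb, -, e⟩ := n0.exists_rep_sqrt le_rfl
  obtain rfl : b = 0 := Number.eq_zero_of_mul_self e
  obtain ⟨h, h'⟩ := opt_sqrt_of_left_neg (x := (-1 : Game.{u}))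
    (fun z hz => by simp [opt_neg_one] at hz) (fun y z hy hz _ _ => by
      rw [(opt_neg_one.1 hy).2, (opt_neg_one.1 hz).2]
      exact (Rep.zero.equiv_iff_eq (hb.add hb)).2 (add_zero 0).symm)
  refine identical_of_opt (fun s z hz' => ?_) fun s z hz' => ?_
  · cases s
    · obtain ⟨r, hr, -, rfl⟩ := (h' z).1 hz'
      obtain ⟨-, rfl⟩ := opt_neg_one.1 hr
      exact ⟨_, hr, hz⟩
    · exact (h z hz').elim
  · obtain ⟨rfl, rfl⟩ := opt_neg_one.1 hz'
    exact ⟨_, (h' _).2 ⟨_, hz', (Rep.zero.le_iff_le n0).2 le_rfl, rfl⟩, hz⟩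

theorem Identical.opt {x y : Game.{u}} (h : Identical x y) {s : Bool} {z : Game.{u}} :
    (Opt s z x → ∃ w, Opt s w y ∧ Identical z w) ∧
      (Opt s z y → ∃ w, Opt s w x ∧ Identical w z) := by
  cases x
  cases y
  obtain ⟨h₁, h₂, h₃, h₄⟩ := h
  cases s
  · exact ⟨by rintro ⟨i, rfl⟩; obtain ⟨j, hj⟩ := h₃ i; exact ⟨_, ⟨j, rfl⟩, hj⟩,
      by rintro ⟨i, rfl⟩; obtain ⟨j, hj⟩ := h₄ i; exact ⟨_, ⟨j, rfl⟩, hj⟩⟩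
  · exact ⟨by rintro ⟨i, rfl⟩; obtain ⟨j, hj⟩ := h₁ i; exact ⟨_, ⟨j, rfl⟩, hj⟩,
      by rintro ⟨i, rfl⟩; obtain ⟨j, hj⟩ := h₂ i; exact ⟨_, ⟨j, rfl⟩, hj⟩⟩

theorem Identical.cls_eq {x y : Game.{u}} (h : Identical x y) : cls x = cls y := by
  induction x using optInduction generalizing y with
  | h x ih =>
    refine cls_eq_of_opt (fun s z hz => ?_) fun s z hz => ?_
    · obtain ⟨w, hw, e⟩ := h.opt.1 hz
      exact ⟨w, hw, ih s z hz e⟩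
    · obtain ⟨w, hw, e⟩ := h.opt.2 hz
      exact ⟨w, hw, ih s w hw e⟩

/-- The initial right options of `√y` have values `0` and `z`, and together they generate `(-1 + 0 ·
z)/(0 + z) = -1/z`. Since `z (√(x² + 1) + x) = 1`, this equals `-(√(x² + 1) + x) < -x`. -/
theorem rightPair_spec {x : Game.{u}} (hx : x.IsSurreal) (h : 0 < x) :
    let z := (x * x + 1).sqrt - x
    let y := Game.rightPair 0 (z * z)
    y.IsSurreal ∧ y ≈ -1 ∧ y.sqrt < -x := by
  intro z y
  obtain ⟨a, ha⟩ := hx.exists_rep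
  have a0 := (Rep.zero.lt_iff_lt ha).1 h
  obtain ⟨b, hb, b0, e⟩ := ((ha.mul ha).add Rep.one).exists_rep_sqrt
    (add_nonneg (mul_self_nonneg a) zero_le_one)
  have hab : a < b := lt_of_mul_self_lt_mul_self₀ b0 (by rw [e]; exact lt_add_one _)
  have hz : Rep z (b - a) := hb.sub ha
  have z0 : 0 < b - a := sub_pos.2 hab
  have hzz := hz.mul hz
  have zz0 : 0 < (b - a) * (b - a) := _root_.mul_pos z0 z0
  have optL : ∀ w, ¬ Opt true w y := by rintro _ ⟨⟨⟩, _⟩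
  have opt0 : Opt false 0 y := ⟨⟨false⟩, rfl⟩
  have optz : Opt false (z * z) y := ⟨⟨true⟩, rfl⟩
  have optR : ∀ w, Opt false w y → w = 0 ∨ w = z * z := by
    rintro _ ⟨⟨_ | _⟩, rfl⟩
    exacts [.inl rfl, .inr rfl]
  have ys : y.IsSurreal := by
    refine isSurreal_iff.2 ⟨fun l r hl => (optL l hl).elim, fun s w hw => ?_⟩
    cases s
    · rcases optR w hw with rfl | rfl
      exacts [isSurreal_zero, hzz.1]
    · exact (optL w hw).elim
  obtain ⟨c, hc⟩ := ys.exists_rep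
  -- The right option `z²` exceeds the right option `0`, so it does not affect the value of `y`,
  -- although its root enters the recursion for `√y`.
  have c1 : c = -1 := by
    refine le_antisymm (hc.le_of_opt Rep.one.neg (fun w hw => (optL w hw).elim) fun w hw => ?_)
      (Rep.one.neg.le_of_opt hc (fun w hw => ?_) fun w hw => ?_)
    · obtain ⟨v, hv, rfl⟩ := opt_neg.1 hw
      obtain ⟨-, rfl⟩ := opt_one.1 hv
      exact ⟨-0, Rep.zero.neg, by simpa using hc.lt_right opt0 Rep.zero⟩
    · obtain ⟨v, hv, rfl⟩ := opt_neg.1 hw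
      exact absurd (opt_one.1 hv).1 (by decide)
    · rcases optR w hw with rfl | rfl
      · exact ⟨0, Rep.zero, by linarith⟩
      · exact ⟨_, hzz, by linarith⟩
  subst c1
  refine ⟨ys, (hc.equiv_iff_eq Rep.one.neg).2 rfl, ?_⟩
  obtain ⟨s, hs, s0, es⟩ := hzz.exists_rep_sqrt zz0.le
  obtain ⟨o, ho, -, eo⟩ := Rep.zero.exists_rep_sqrt le_rfl
  obtain rfl := (mul_self_inj s0 z0.le).1 es
  obtain rfl : o = 0 := Number.eq_zero_of_mul_self eo
  -- The two families are those in the definition of `√y`, written out so that `step` speaks of `√y`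
  -- by unfolding.
  have step := sqrtClosure_step (x := y) (A := ⟨{i : PEmpty.{u+1} // (0 : Game.{u}) ≤ i.elim},
    fun i => Game.sqrt i.1.elim⟩) (B := ⟨{j : ULift.{u} Bool // 0 ≤ if j.down then z * z else 0},
    fun j => Game.sqrt (if j.1.down then z * z else 0)⟩) (s := false) (t := false)
    (y := Game.sqrt 0) (z := Game.sqrt (z * z))
    (opt_false_sqrtClosure.2 ⟨0, ⟨⟨⟨false⟩, le_rfl⟩, rfl⟩⟩)
    (opt_false_sqrtClosure.2 ⟨0, ⟨⟨⟨true⟩, (Rep.zero.le_iff_le hzz).2 zz0.le⟩, rfl⟩⟩)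
    (fun h => z0.ne (by simpa using (Rep.zero.equiv_iff_eq (ho.add hs)).1 h))
  obtain ⟨t, ht⟩ := ys.sqrt.exists_rep
  have lt := ht.lt_right (step.1 rfl) ((hc.add (ho.mul hs)).div (ho.add hs))
  refine (ht.lt_iff_lt ha.neg).2 (lt.trans_le ?_)
  -- What remains is `a (b - a) ≤ 1`, which follows from `(b - a)(b + a) = 1` and `b ≥ 0`.
  rw [zero_mul, add_zero, zero_add, div_le_iff₀ z0]
  nlinarith

end Game

end

theorem mainTheorem4 :
    -- the square root of a surreal number is a surreal number
    (∀ x : Game.{u}, x.IsSurreal → x.sqrt.IsSurreal) ∧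
    (∀ x : Game.{u}, x.IsSurreal → 0 ≤ x → (x * x).sqrt ≈ x) ∧
    (∀ x : Game.{u}, x.IsSurreal → 0 < x → (x.sqrt)⁻¹ ≈ (x⁻¹).sqrt) ∧
    -- two representatives of `-1` with inequivalent square roots
    (∃ y z : Game.{u}, y.IsSurreal ∧ z.IsSurreal ∧ y ≈ -1 ∧ z ≈ -1 ∧ ¬ y.sqrt ≈ z.sqrt) ∧
    -- explicitly: `√(-1) = -1`, as pairs of sets
    Game.Identical (-1 : Game.{u}).sqrt (-1) ∧
    -- and for `x > 0`, the representative `y = { | 0, (√(x x + 1) - x) (√(x x + 1) - x)}` of `-1`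
    (∀ x : Game.{u}, x.IsSurreal → 0 < x →
      let z := (x * x + 1).sqrt - x
      let y := Game.rightPair 0 (z * z)
      y.IsSurreal ∧ y ≈ -1 ∧ y.sqrt < -x) ∧
    -- below every negative number lies the square root of some representative of `-1`
    (∀ x : Game.{u}, x.IsSurreal → x < 0 →
      ∃ y : Game.{u}, y.IsSurreal ∧ y ≈ -1 ∧ y.sqrt < x) := by
  refine ⟨fun x hx => hx.sqrt, fun x => Game.sqrt_mul_self_equiv, fun x => Game.inv_sqrt_equiv, ?_,
    Game.sqrt_neg_one_identical, fun x => Game.rightPair_spec, fun x hx h => ?_⟩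
  -- Already `x = 1` separates the roots: `√y < -1`, while `√(-1)` is `-1`.
  · obtain ⟨hy, hy1, hlt⟩ := Game.rightPair_spec Game.isSurreal_one
      ((Game.Rep.zero.lt_iff_lt Game.Rep.one).2 zero_lt_one)
    refine ⟨_, -1, hy, Game.isSurreal_one.neg, hy1, ⟨le_rfl, le_rfl⟩, fun h => hlt.2 ?_⟩
    exact (Game.cls_eq.1 Game.sqrt_neg_one_identical.cls_eq).2.trans h.2
  · obtain ⟨a, ha⟩ := hx.exists_rep
    obtain ⟨hy, hy1, hlt⟩ := Game.rightPair_spec hx.neg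
      ((Game.Rep.zero.lt_iff_lt ha.neg).2 (neg_pos.2 ((ha.lt_iff_lt Game.Rep.zero).1 h)))
    rw [Game.game_neg_neg] at hlt
    exact ⟨_, hy, hy1, hlt⟩
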